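/- **Setting.** All objects are indexed by the security parameter $\lambda\in\mathbb N$. Let $(\mathsf{Gen},\mathsf{Enc},\mathsf{Dec})$ be the key generation, the encryption of classical messages and the decryption of classical ciphertexts of a quantum homomorphic encryption scheme. Assume that encryptions of any two (families of) messages under a fresh key are computationally indistinguishable for nonuniform polynomial-size quantum circuits (this follows from IND-CPA security; no other property of the scheme is used). Let $n=n(\lambda)$ and let $S=S_\lambda\subseteq\{0,1\}^{n}$ be $\mu$-biased with $\mu<1$: $S\neq\emptyset$ and $|\mathbb E_{a\in S}(-1)^{a\cdot b}|\le\mu$ for all $b\in\{0,1\}^n\setminus\{0^n\}$. **Compiled tests.** When the players' questions are $(x,y)$, the verifier samples $sk\leftarrow\mathsf{Gen}(1^\lambda)$ and $c\leftarrow\mathsf{Enc}_{sk}(x)$, sends $c$, receives $\alpha$, sends $y$ in the clear, receives $v$, and applies the predicate of the test to Alice's answer $\mathsf{Dec}_{sk}(\alpha)$ and Bob's answer $v$. *Succinct Pauli braiding test.* Choose $a,b\in S$ uniformly. * If $a\cdot b=0$ (mod 2), commutation test: Alice is asked $(\mathsf{com},a,b)$ and answers bits $(u_a,u_b)$. Bob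 is asked a uniformly random $W\in\{X,Z\}$ and answers $v\in\{0,1\}^n$. Accept iff $a\cdot v=u_a$ (if $W=Z$), respectively $b\cdot v=u_b$ (if $W=X$). * If $a\cdot b=1$ (mod 2), anticommutation test (Magic Square): choose a uniformly random cell $j$ of a $3\times3$ grid and, uniformly, the row or the column through it. Alice is asked $(\mathsf{MS},a,b,\text{line})$ and answers three bits, one for each cell of the line, which must have even sum for a row and odd sum for a column. Let $u_j$ be her bit for the cell $j$. If $j$ is the top centre cell, Bob is asked $Z$, answers $v\in\{0,1\}^n$, and $a\cdot v=u_j$ is required. If $j$ is the centre left cell, Bob is asked $X$, answers $v\in\{0,1\}^n$, and $b\cdot v=u_j$ is required. Otherwise Bob is asked $(\mathsf{MS},a,b,j)$, answers one bit $v$, and $v=u_j$ is required. *Pure basis consistency test* (the case of the mixed-versus-pure basis test in which both players get the same basis): a uniformly random $W\in\{X,Z\}$ is sent to both Alice and Bob, who answer $u,v\in\{0,1\}^n$. Accept iff $u=v$. **Prover.** An efficient prover has an initial pure state $|\psi\rangle$ on polynomially many qubits. On ciphertext $c$ it applies a polynomial-size circuit and measures some qubits, with outcome $\alpha$ and unnormalised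 post-measurement vector $|\psi^c_\alpha\rangle=A^c_\alpha|\psi\rangle$. On Bob's question $y$ it applies a polynomial-size circuit and measures some qubits. Let $\{P^W_u\}_{u\in\{0,1\}^n}$ be its projective measurement on question $W\in\{X,Z\}$, and put $W(a)=\sum_u(-1)^{u\cdot a}P^W_u$. For an Alice question $q$ let $\psi^{\mathsf{Enc}(q)}=\mathbb E_{sk}\,\mathbb E_{c\leftarrow\mathsf{Enc}_{sk}(q)}\sum_\alpha|\psi^c_\alpha\rangle\langle\psi^c_\alpha|$, and $\|A\|_\rho^2=\mathrm{Tr}[A^\dagger A\rho]$. (Either convention for advice may be used for provers and distinguishers alike: the workspace starts in $|0\cdots0\rangle$, with classical advice built into the circuits, or it starts in an arbitrary pure state.) **Lemma.** For every $\mu<1$ there is a constant $C$, depending only on $\mu$, such that the following holds. If an efficient prover wins the compiled succinct Pauli braiding test and the compiled pure basis consistency test each with probability at least $1-\epsilon(\lambda)$ for every $\lambda$, then there is a negligible function $\eta$ such that for every $\lambda$ and every Alice question $q$ $$\mathbb E_{a,b\in\{0,1\}^n}\big\|Z(a)X(b)-(-1)^{a\cdot b}X(b)Z(a)\big\|^2_{\psi^{\mathsf{Enc}(q)}}\le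 C\,\epsilon(\lambda)+\eta(\lambda).$$ The Alice questions are $(\mathsf{com},a,b)$ and $(\mathsf{MS},a,b,\text{line})$ for $a,b\in S$, the bases $X$ and $Z$, the Pauli strings $w\in\{\mathds 1,X,Z\}^n$, and $\mathsf{tele}$. -/

import Mathlib

noncomputable section

namespace PauliBraiding

/-! ### Bit strings, small-bias sets -/

/-- Bit strings of length `n`. -/
abbrev Bits (n : ℕ) : Type := Fin n → Bool

/-- The number of positions where both strings are `1`; `a · b` is its parity, and
`(-1) ^ dot a b` is the sign `(-1)^{a · b}`. -/
def dot {n : ℕ} (a b : Bits n) : ℕ :=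
  (Finset.univ.filter fun i => a i = true ∧ b i = true).card

/-- The bit `a · b`, i.e. the parity of the bits of `b` in the positions where `a` is `1`. -/
def parity {n : ℕ} (a b : Bits n) : Bool := decide (Odd (dot a b))

/-- `S ⊆ {0,1}^n` is a (nonempty) `μ`-biased set. -/
def IsBiased (μ : ℝ) {n : ℕ} (S : Finset (Bits n)) : Prop :=
  S.Nonempty ∧ ∀ b : Bits n, b ≠ (fun _ => false) →
    |(∑ a ∈ S, (-1 : ℝ) ^ dot a b) / (S.card : ℝ)| ≤ μ

/-! ### Qubit registers, circuits, measurements -/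

/-- Vectors of the Hilbert space of `N` qubits, in the computational basis. -/
abbrev Ket (N : ℕ) : Type := Bits N → ℂ

/-- Operators on `N` qubits. -/
abbrev QOp (N : ℕ) : Type := Matrix (Bits N) (Bits N) ℂ

/-- A two-qubit gate on `N` wires: an arbitrary unitary acting on two distinct wires. -/
structure Gate (N : ℕ) where
  fst : Fin N
  snd : Fin N
  ne : fst ≠ snd
  U : Matrix.unitaryGroup (Bool × Bool) ℂ

/-- The operator of a gate: `U` on the two wires, the identity on all others. -/
def Gate.op {N : ℕ} (g : Gate N) : QOp N :=
  open Classical in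
  Matrix.of fun x y =>
    if ∀ i, i ≠ g.fst → i ≠ g.snd → x i = y i then
      (g.U : Matrix (Bool × Bool) (Bool × Bool) ℂ) (x g.fst, x g.snd) (y g.fst, y g.snd)
    else 0

/-- A circuit is a list of gates, the head being applied first; its size is its length. -/
abbrev Circuit (N : ℕ) : Type := List (Gate N)

/-- The unitary computed by a circuit. -/
def circuitOp {N : ℕ} : Circuit N → QOp N
  | [] => 1
  | g :: C => circuitOp C * g.op

/-- The projection onto outcome `s` when the wires `r` are measured in the computational basis. -/
def readProj {l N : ℕ} (r : Fin l ↪ Fin N) (s : Bits l) : QOp N :=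
  open Classical in
  Matrix.diagonal fun x => if ∀ i, x (r i) = s i then 1 else 0

/-- The product vector `|c⟩ ⊗ |ψ⟩`. -/
def loadKet {l w : ℕ} (c : Bits l) (ψ : Ket w) : Ket (l + w) :=
  open Classical in
  fun x => if ∀ i, x (Fin.castAdd w i) = c i then ψ (fun i => x (Fin.natAdd l i)) else 0

/-- The density matrix `|v⟩⟨v|`. -/
def ketbra {N : ℕ} (v : Ket N) : QOp N := Matrix.vecMulVec v (star v)

/-- The squared state-dependent norm `‖A‖²_ρ = Tr[A† A ρ]`. -/
def stateNormSq {N : ℕ} (A ρ : QOp N) : ℝ :=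
  (Matrix.trace (Matrix.conjTranspose A * A * ρ)).re

/-! ### Efficiency -/

/-- The two usual conventions for the initial workspace of a nonuniform polynomial-size
quantum machine. -/
inductive Advice
  | classical
  | quantum

/-- With classical advice (which is contained in the circuit) the workspace starts in `|0…0⟩`; with
quantum advice it starts in an arbitrary pure state. -/
def Advice.Allows (adv : Advice) {w : ℕ} (ψ : Ket w) : Prop :=
  match adv with
  | .classical => ψ = Pi.single (fun _ => false) 1
  | .quantum => ∑ x, ‖ψ x‖ ^ 2 = 1

/-- Polynomially bounded functions of the security parameter. -/
def PolyBounded (f : ℕ → ℕ) : Prop :=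
  ∃ p : Polynomial ℕ, ∀ k, f k ≤ p.eval k

/-- Negligible functions of the security parameter. -/
def Negligible (η : ℕ → ℝ) : Prop :=
  Asymptotics.SuperpolynomialDecay Filter.atTop (fun k : ℕ => (k : ℝ)) η

/-! ### Encryption -/

/-- The part of a homomorphic encryption scheme that the verifier of a compiled game uses: key
generation, encryption of classical messages, decryption of classical ciphertexts. The argument
`k` is the security parameter. -/
structure EncryptionScheme where
  keyLen : ℕ → ℕ
  msgLen : ℕ → ℕ
  ctLen : ℕ → ℕ
  gen : ∀ k, PMF (Bits (keyLen k))
  enc : ∀ k, Bits (keyLen k) → Bits (msgLen k) → PMF (Bits (ctLen k))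
  dec : ∀ k, Bits (keyLen k) → List Bool → List Bool

/-- A family of quantum distinguishers: the ciphertext is loaded into the first wires, the
rest of the wires holds the workspace, and the output bit is read off one wire. -/
structure Adversary (E : EncryptionScheme) where
  work : ℕ → ℕ
  init : ∀ k, Ket (work k)
  circuit : ∀ k, Circuit (E.ctLen k + work k)
  out : ∀ k, Fin (E.ctLen k + work k)

/-- Polynomially many wires and gates, and an allowed initial workspace. -/
def Adversary.Efficient {E : EncryptionScheme} (adv : Advice) (A : Adversary E) : Prop :=
  (∀ k, adv.Allows (A.init k)) ∧
    PolyBounded fun k => E.ctLen k + A.work k + (A.circuit k).length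

/-- The probability that the distinguisher outputs `1` on ciphertext `c`. -/
def Adversary.acceptOn {E : EncryptionScheme} (A : Adversary E) (k : ℕ)
    (c : Bits (E.ctLen k)) : ℝ :=
  ∑ x, if x (A.out k) = true then
    ‖(circuitOp (A.circuit k)).mulVec (loadKet c (A.init k)) x‖ ^ 2 else 0

/-- The probability that the distinguisher outputs `1` on an encryption of `m` under a fresh
key. -/
def Adversary.accept {E : EncryptionScheme} (A : Adversary E) (k : ℕ)
    (m : Bits (E.msgLen k)) : ℝ :=
  ∑ sk, (E.gen k sk).toReal * ∑ c, (E.enc k sk m c).toReal * A.acceptOn k c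

/-- Encryptions of any two messages are indistinguishable for efficient quantum distinguishers
(a consequence of IND-CPA security, since no encryption queries are granted). -/
def EncryptionScheme.Secure (E : EncryptionScheme) (adv : Advice) : Prop :=
  ∀ A : Adversary E, A.Efficient adv → ∀ m₀ m₁ : ∀ k, Bits (E.msgLen k),
    Negligible fun k => |A.accept k (m₀ k) - A.accept k (m₁ k)|

/-! ### Questions -/

inductive Basis
  | X
  | Z

inductive PauliLabel
  | I
  | X
  | Z

/-- A row or a column of the `3 × 3` square. -/
inductive Line
  | row (r : Fin 3)
  | col (c : Fin 3)

/-- Alice's questions. -/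
inductive AliceQuestion {n : ℕ} (S : Finset (Bits n))
  | com (a b : {a : Bits n // a ∈ S})
  | ms (a b : {a : Bits n // a ∈ S}) (L : Line)
  | basis (W : Basis)
  | mixed (w : Fin n → PauliLabel)
  | tele

/-- Bob's questions in the Pauli braiding test. -/
inductive BobQuestion {n : ℕ} (S : Finset (Bits n))
  | basis (W : Basis)
  | cell (a b : {a : Bits n // a ∈ S}) (j : Fin 3 × Fin 3)

/-- Bob answers a basis question with `n` bits and a cell question with one bit. -/
def BobQuestion.ansLen {n : ℕ} {S : Finset (Bits n)} : BobQuestion S → ℕ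
  | .basis _ => n
  | .cell _ _ _ => 1

/-- The input of the test for each security parameter: the number `n` of qubits, the set `S`
of strings, and the encoding of Alice's questions as plaintexts of the encryption scheme. (No
property of the encoding is needed.) -/
structure Setup (E : EncryptionScheme) where
  n : ℕ → ℕ
  S : ∀ k, Finset (Bits (n k))
  encode : ∀ k, AliceQuestion (S k) → Bits (E.msgLen k)

/-! ### The prover -/

/-- A prover in the compiled game. All its qubits are `ctLen` wires, on which it receives the
encrypted question, and `work` wires, initially in the state `init`. In the first round it
applies `aliceCircuit` and measures the wires `aliceOut`; in the second round, on question `y`, it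
applies `bobCircuit y` and measures the wires `bobOut y`. -/
structure Prover {E : EncryptionScheme} (G : Setup E) where
  work : ℕ → ℕ
  init : ∀ k, Ket (work k)
  aliceCircuit : ∀ k, Circuit (E.ctLen k + work k)
  aliceLen : ℕ → ℕ
  aliceOut : ∀ k, Fin (aliceLen k) ↪ Fin (E.ctLen k + work k)
  bobCircuit : ∀ k, BobQuestion (G.S k) → Circuit (E.ctLen k + work k)
  bobOut : ∀ k (y : BobQuestion (G.S k)), Fin y.ansLen ↪ Fin (E.ctLen k + work k)

namespace Prover

variable {E : EncryptionScheme} {G : Setup E}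

/-- Polynomially many wires, polynomial-size circuits, and an allowed initial workspace. -/
def Efficient (adv : Advice) (P : Prover G) : Prop :=
  (∀ k, adv.Allows (P.init k)) ∧
    ∃ p : Polynomial ℕ, ∀ k,
      E.ctLen k + P.work k + (P.aliceCircuit k).length ≤ p.eval k ∧
      ∀ y, (P.bobCircuit k y).length ≤ p.eval k

/-- The unnormalised post-measurement vector `|ψ^c_α⟩` after the first round. -/
def postKet (P : Prover G) (k : ℕ) (c : Bits (E.ctLen k)) (α : Bits (P.aliceLen k)) :
    Ket (E.ctLen k + P.work k) :=
  (readProj (P.aliceOut k) α).mulVec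
    ((circuitOp (P.aliceCircuit k)).mulVec (loadKet c (P.init k)))

/-- `ψ^{Enc(q)}`: the average over the key and the ciphertext of `∑_α |ψ^c_α⟩⟨ψ^c_α|`. -/
def encState (P : Prover G) (k : ℕ) (q : AliceQuestion (G.S k)) :
    QOp (E.ctLen k + P.work k) :=
  ∑ sk, ((E.gen k sk).toReal : ℂ) • ∑ c, ((E.enc k sk (G.encode k q) c).toReal : ℂ) •
    ∑ α, ketbra (P.postKet k c α)

/-- Bob's projective measurement on question `y`. -/
def bobMeas (P : Prover G) (k : ℕ) (y : BobQuestion (G.S k)) (b : Bits y.ansLen) :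
    QOp (E.ctLen k + P.work k) :=
  Matrix.conjTranspose (circuitOp (P.bobCircuit k y)) * readProj (P.bobOut k y) b *
    circuitOp (P.bobCircuit k y)

/-- The pure basis observable `W(a) = ∑_u (-1)^{u · a} P^W_u`. -/
def obs (P : Prover G) (k : ℕ) (W : Basis) (a : Bits (G.n k)) :
    QOp (E.ctLen k + P.work k) :=
  ∑ u : Bits (G.n k), (-1 : ℂ) ^ dot u a • P.bobMeas k (.basis W) u

/-- The probability that the verifier's predicate `V` holds of Alice's decrypted answer and Bob's
answer when the encrypted question is `x` and the plain question is `y`. -/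
def roundWin (P : Prover G) (k : ℕ) (x : AliceQuestion (G.S k)) (y : BobQuestion (G.S k))
    (V : List Bool → Bits y.ansLen → Prop) : ℝ :=
  open Classical in
  ∑ sk, (E.gen k sk).toReal * ∑ c, (E.enc k sk (G.encode k x) c).toReal *
    ∑ α, ∑ b, if V (E.dec k sk (List.ofFn α)) b then
      (Matrix.trace (P.bobMeas k y b * ketbra (P.postKet k c α))).re else 0

/-- The probability of winning the compiled commutation test on `a`, `b`. -/
def comWin (P : Prover G) (k : ℕ) (a b : {a : Bits (G.n k) // a ∈ G.S k}) : ℝ :=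
  (1 / 2) *
    (P.roundWin k (.com a b) (.basis .Z)
        (fun u v => ∃ ua ub, u = [ua, ub] ∧ parity a.1 v = ua) +
      P.roundWin k (.com a b) (.basis .X)
        (fun u v => ∃ ua ub, u = [ua, ub] ∧ parity b.1 v = ub))

end Prover

/-- The Magic Square constraint: the three bits have even parity on a row, odd parity on a
column. -/
def Line.Constraint (L : Line) (u : Fin 3 → Bool) : Prop :=
  match L with
  | .row _ => xor (xor (u 0) (u 1)) (u 2) = false
  | .col _ => xor (xor (u 0) (u 1)) (u 2) = true

/-- The position of the cell `j = (row, column)` within a line through it. -/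
def Line.pos (L : Line) (j : Fin 3 × Fin 3) : Fin 3 :=
  match L with
  | .row _ => j.2
  | .col _ => j.1

namespace Prover

variable {E : EncryptionScheme} {G : Setup E}

/-- The probability of winning the compiled anticommutation test on `a`, `b` when the cell is `j`
and Alice is asked the line `L` through it. For the top centre and the centre left cell Bob is
asked the basis question `Z`, respectively `X`. -/
def msRound (P : Prover G) (k : ℕ) (a b : {a : Bits (G.n k) // a ∈ G.S k})
    (L : Line) (j : Fin 3 × Fin 3) : ℝ :=
  if j = (0, 1) then
    P.roundWin k (.ms a b L) (.basis .Z) fun ans v =>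
      ∃ u : Fin 3 → Bool, ans = List.ofFn u ∧ L.Constraint u ∧ parity a.1 v = u (L.pos j)
  else if j = (1, 0) then
    P.roundWin k (.ms a b L) (.basis .X) fun ans v =>
      ∃ u : Fin 3 → Bool, ans = List.ofFn u ∧ L.Constraint u ∧ parity b.1 v = u (L.pos j)
  else
    P.roundWin k (.ms a b L) (.cell a b j) fun ans v =>
      ∃ u : Fin 3 → Bool, ans = List.ofFn u ∧ L.Constraint u ∧ v (0 : Fin 1) = u (L.pos j)

/-- The probability of winning the compiled anticommutation test on `a`, `b`: a uniformly random
cell, and a uniformly random choice of the row or the column through it. -/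
def msWin (P : Prover G) (k : ℕ) (a b : {a : Bits (G.n k) // a ∈ G.S k}) : ℝ :=
  (1 / 9) * ∑ j : Fin 3 × Fin 3,
    (1 / 2) * (P.msRound k a b (.row j.1) j + P.msRound k a b (.col j.2) j)

/-- The probability of winning the compiled Pauli braiding test: `a`, `b` are uniform in `S`, and
the commutation or the anticommutation test is executed according to the parity of `a · b`. -/
def braidingWin (P : Prover G) (k : ℕ) : ℝ :=
  (1 / ((G.S k).card : ℝ) ^ 2) *
    ∑ a : {a : Bits (G.n k) // a ∈ G.S k}, ∑ b : {a : Bits (G.n k) // a ∈ G.S k},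
      if parity a.1 b.1 = true then P.msWin k a b else P.comWin k a b

/-- The probability of winning the compiled pure basis consistency test: the same uniformly random
basis is sent to both players, whose `n`-bit answers have to be equal. -/
def consistencyWin (P : Prover G) (k : ℕ) : ℝ :=
  (1 / 2) *
    (P.roundWin k (.basis .Z) (.basis .Z)
        (fun u v => u = List.ofFn (show Bits (G.n k) from v)) +
      P.roundWin k (.basis .X) (.basis .X)
        (fun u v => u = List.ofFn (show Bits (G.n k) from v)))

/-- The average of `‖Z(a) X(b) - (-1)^{a·b} X(b) Z(a)‖²` in the state `ψ^{Enc(q)}` over uniform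
`a, b ∈ {0,1}^n`. -/
def braidingDefect (P : Prover G) (k : ℕ) (q : AliceQuestion (G.S k)) : ℝ :=
  (1 / ((2 : ℝ) ^ G.n k) ^ 2) * ∑ a : Bits (G.n k), ∑ b : Bits (G.n k),
    stateNormSq
      (P.obs k .Z a * P.obs k .X b - (-1 : ℂ) ^ dot a b • (P.obs k .X b * P.obs k .Z a))
      (P.encState k q)

end Prover

end PauliBraiding

end

/-! The proof combines local rigidity, switching of the encrypted question, and an extension from
`S` to all strings.

Rigidity. On the state left by an encrypted question, winning forces Bob's observable to act as the
sign decrypted from Alice's answer, up to four times the losing probability (`avg_letterOp_sub_le`).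
Observables with a common approximate eigenvector inherit the relations between their eigenvalues:
they commute on the state of a commutation question, and they satisfy the product constraint of a
line on the state of that line.

Switching. The sign needs the secret key, but the resulting relation between words `U`, `V` in Bob's
observables does not mention it. Its defect `‖U - sV‖²` is four times the output probability of
Hadamard tests, averaged over random phases that replace Alice's measurement. These tests are
efficient distinguishers, so the defect is the same for all questions up to a negligible error
(`exists_negligible_switch`). Relations of different lines can thus be used on one state, where
`dist_ms_le` chains them into anticommutation; `sum_dist_le` averages over `S`.

Extension. On the state of an encrypted basis question `W` with decrypted answer `u`, consistency
gives `W(b)ψ ≈ (-1)^{u·b} ψ` for every string `b`. The braiding of an observable `x` of a string `a`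
with `W(b)` then says that `xψ` is nearly an eigenvector of `W(b)` with eigenvalue `(-1)^{(a+u)·b}`.
For a fixed vector and character, every wrong measurement outcome has weight 2 in the average over
all `b` and at least `2(1-μ)` in the average over `S`, so passing to all strings costs a factor
`1/(1-μ)` (`bias_extension`, `sum_dist_extension`). `braidingDefect_le` does this for `b` on the
state of `X`, switches, does it for `a` on the state of `Z`, and switches to `q`. -/

namespace PauliBraiding

open Matrix Finset

/-! ### Squared norms -/

/-- The squared Euclidean norm of a vector. -/
noncomputable def nsq {N : ℕ} (v : Ket N) : ℝ := ∑ x, ‖v x‖ ^ 2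

lemma nsq_nonneg {N : ℕ} (v : Ket N) : 0 ≤ nsq v := by
  unfold nsq; positivity

lemma nsq_smul {N : ℕ} (c : ℂ) (v : Ket N) : nsq (c • v) = ‖c‖ ^ 2 * nsq v := by
  simp [nsq, mul_pow, Finset.mul_sum]

lemma nsq_neg {N : ℕ} (v : Ket N) : nsq (-v) = nsq v := by
  simp [nsq]

@[simp] lemma nsq_zero {N : ℕ} : nsq (0 : Ket N) = 0 := by
  simp [nsq]

lemma nsq_sum_le {N : ℕ} {ι : Type*} (s : Finset ι) (v : ι → Ket N) :
    nsq (∑ i ∈ s, v i) ≤ s.card * ∑ i ∈ s, nsq (v i) := by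
  unfold nsq
  rw [Finset.sum_comm, Finset.mul_sum]
  refine Finset.sum_le_sum fun x _ => ?_
  refine le_trans ?_ sq_sum_le_card_mul_sum_sq
  rw [Finset.sum_apply]
  gcongr
  exact norm_sum_le _ _

lemma nsq_add_le {N : ℕ} (u v : Ket N) : nsq (u + v) ≤ 2 * nsq u + 2 * nsq v := by
  have h := nsq_sum_le univ ![u, v]
  simp at h
  linarith

lemma star_dotProduct_self {N : ℕ} (v : Ket N) : star v ⬝ᵥ v = (nsq v : ℂ) := by
  simp only [nsq, dotProduct, Pi.star_apply, RCLike.star_def, Complex.ofReal_sum,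
    Complex.ofReal_pow]
  exact Finset.sum_congr rfl fun x _ => Complex.conj_mul' _

lemma nsq_mulVec {N : ℕ} (U : QOp N) (v : Ket N) :
    (nsq (U *ᵥ v) : ℂ) = star v ⬝ᵥ ((Uᴴ * U) *ᵥ v) := by
  rw [← star_dotProduct_self, star_mulVec, ← dotProduct_mulVec, mulVec_mulVec]

lemma nsq_mulVec_of_isometry {N : ℕ} {U : QOp N} (h : Uᴴ * U = 1) (v : Ket N) :
    nsq (U *ᵥ v) = nsq v := by
  have := nsq_mulVec U v
  rw [h, one_mulVec, star_dotProduct_self] at this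
  exact_mod_cast this

lemma trace_mul_ketbra {N : ℕ} (A : QOp N) (v : Ket N) :
    trace (A * ketbra v) = star v ⬝ᵥ (A *ᵥ v) := by
  rw [ketbra, mul_vecMulVec, trace_vecMulVec, dotProduct_comm]

lemma stateNormSq_ketbra {N : ℕ} (A : QOp N) (v : Ket N) :
    stateNormSq A (ketbra v) = nsq (A *ᵥ v) := by
  rw [stateNormSq, trace_mul_ketbra, ← nsq_mulVec, Complex.ofReal_re]

/-! ### Signs -/

/-- Written as a product over positions, identities of characters become checks bit by bit and sums
over strings factor. A general ring is used because both complex phases and real averages occur. -/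
lemma neg_one_pow_dot {R : Type*} [CommRing R] {n : ℕ} (a b : Bits n) :
    (-1 : R) ^ dot a b = ∏ i, if (a i && b i) = true then -1 else 1 := by
  rw [dot, Finset.prod_ite]
  simp

lemma dot_comm {n : ℕ} (a b : Bits n) : dot a b = dot b a := by
  simp [dot, and_comm]

/-- The bitwise sum of two strings. -/
def bxor {n : ℕ} (a b : Bits n) : Bits n := fun i => xor (a i) (b i)

lemma bxor_eq_zero {n : ℕ} {a b : Bits n} : bxor a b = (fun _ => false) ↔ a = b := by
  simp [bxor, funext_iff]

lemma neg_one_pow_dot_bxor {R : Type*} [CommRing R] {n : ℕ} (a b c : Bits n) :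
    (-1 : R) ^ dot (bxor a b) c = (-1) ^ dot a c * (-1) ^ dot b c := by
  simp only [neg_one_pow_dot, bxor, ← Finset.prod_mul_distrib]
  have h : ∀ p q r : Bool, (if (xor p q && r) = true then (-1 : R) else 1) =
      (if (p && r) = true then -1 else 1) * if (q && r) = true then -1 else 1 := by
    intro p q r; cases p <;> cases q <;> cases r <;> simp
  exact Finset.prod_congr rfl fun i _ => h _ _ _

lemma neg_one_pow_mul_self {R : Type*} [CommRing R] (m : ℕ) :
    (-1 : R) ^ m * (-1) ^ m = 1 := by
  rw [← mul_pow]; simp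

lemma norm_neg_one_pow (m : ℕ) : ‖(-1 : ℂ) ^ m‖ = 1 := by simp

lemma sum_neg_one_pow_dot {R : Type*} [CommRing R] {n : ℕ} (a : Bits n) :
    ∑ z : Bits n, (-1 : R) ^ dot a z = if a = (fun _ => false) then 2 ^ n else 0 := by
  simp only [neg_one_pow_dot]
  rw [← Fintype.piFinset_univ, Finset.sum_prod_piFinset univ
    (fun i (c : Bool) => if (a i && c) = true then (-1 : R) else 1)]
  split_ifs with h
  · subst h; simp
  · obtain ⟨i, hi⟩ : ∃ i, a i = true := by
      by_contra! hc; exact h (funext fun i => by simpa using hc i)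
    exact Finset.prod_eq_zero (mem_univ i) (by simp [hi])

lemma neg_one_pow_eq_parity {R : Type*} [CommRing R] {n : ℕ} (a b : Bits n) :
    (-1 : R) ^ dot a b = if parity a b = true then -1 else 1 := by
  unfold parity
  rcases Nat.even_or_odd (dot a b) with h | h
  · simp [h.neg_one_pow, Nat.not_odd_iff_even.2 h]
  · simp [h.neg_one_pow, h]

lemma parity_comm {n : ℕ} (a b : Bits n) : parity a b = parity b a := by
  simp [parity, dot_comm]

/-- Random phases dephase. -/
lemma sum_norm_sq_sum_sign {m : ℕ} (w : Bits m → ℂ) :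
    ∑ z : Bits m, ‖∑ α, (-1 : ℂ) ^ dot α z * w α‖ ^ 2 = 2 ^ m * ∑ α, ‖w α‖ ^ 2 := by
  have key : ∑ z : Bits m, ((‖∑ α, (-1 : ℂ) ^ dot α z * w α‖ ^ 2 : ℝ) : ℂ)
      = ((2 ^ m * ∑ α, ‖w α‖ ^ 2 : ℝ) : ℂ) := by
    push_cast
    simp only [← Complex.conj_mul', map_sum, map_mul, map_pow, map_neg, map_one,
      Finset.sum_mul_sum]
    rw [Finset.sum_comm, Finset.mul_sum]
    refine Finset.sum_congr rfl fun α _ => ?_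
    rw [Finset.sum_comm]
    -- After expanding the square, only `β = α` survives the sum over `z`: for `β ≠ α` the phases
    -- combine to a nontrivial character, that of `bxor α β`.
    rw [Finset.sum_eq_single α]
    · have : ∀ z : Bits m, (-1 : ℂ) ^ dot α z * (starRingEnd ℂ) (w α) *
          ((-1) ^ dot α z * w α) = (starRingEnd ℂ) (w α) * w α := fun z => by
        linear_combination (starRingEnd ℂ) (w α) * w α * neg_one_pow_mul_self (R := ℂ) (dot α z)
      simp [this]
    · intro β _ hβ
      have : ∀ z : Bits m, (-1 : ℂ) ^ dot α z * (starRingEnd ℂ) (w α) *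
          ((-1) ^ dot β z * w β) = (-1) ^ dot (bxor α β) z * ((starRingEnd ℂ) (w α) * w β) :=
        fun z => by rw [neg_one_pow_dot_bxor]; ring
      simp only [this, ← Finset.sum_mul, sum_neg_one_pow_dot]
      rw [if_neg (by rw [bxor_eq_zero]; exact fun h => hβ h.symm), zero_mul]
    · simp
  have := key
  rw [← Complex.ofReal_sum] at this
  exact_mod_cast this

/-! ### Gates and circuits -/

/-- The row of `x` is supported on the strings that agree with `x` off the two wires, and
overwriting two bits lists them. In this form composed gates become composed updates. -/
lemma Gate.op_mulVec {N : ℕ} (g : Gate N) (φ : Ket N) (x : Bits N) :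
    (g.op *ᵥ φ) x = ∑ p : Bool × Bool,
      (g.U : Matrix (Bool × Bool) (Bool × Bool) ℂ) (x g.fst, x g.snd) p *
        φ (Function.update (Function.update x g.fst p.1) g.snd p.2) := by
  have hne := g.ne
  symm
  rw [mulVec, dotProduct]
  apply Fintype.sum_of_injective
    (fun p : Bool × Bool => Function.update (Function.update x g.fst p.1) g.snd p.2)
  · intro p q h
    have h1 := congrFun h g.fst
    have h2 := congrFun h g.snd
    simp [hne] at h1 h2
    exact Prod.ext h1 h2
  · intro y hy
    have : ¬ ∀ i, i ≠ g.fst → i ≠ g.snd → x i = y i := by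
      intro h
      apply hy
      refine ⟨(y g.fst, y g.snd), funext fun i => ?_⟩
      by_cases h2 : i = g.snd
      · subst h2; simp
      by_cases h1 : i = g.fst
      · subst h1; simp [hne]
      · simp [h1, h2, h i h1 h2]
    simp [Gate.op, this]
  · intro p
    have : ∀ i, i ≠ g.fst → i ≠ g.snd →
        x i = Function.update (Function.update x g.fst p.1) g.snd p.2 i := by
      intro i h1 h2; simp [h1, h2]
    rw [Gate.op, of_apply, if_pos this]
    simp [hne]

lemma Gate.op_apply_of {N : ℕ} (g : Gate N) {x y : Bits N}
    (h : ∀ i, i ≠ g.fst → i ≠ g.snd → x i = y i) :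
    g.op x y = (g.U : Matrix (Bool × Bool) (Bool × Bool) ℂ)
      (x g.fst, x g.snd) (y g.fst, y g.snd) := by
  rw [Gate.op, of_apply, if_pos h]

lemma Gate.op_apply_of_not {N : ℕ} (g : Gate N) {x y : Bits N}
    (h : ¬ ∀ i, i ≠ g.fst → i ≠ g.snd → x i = y i) : g.op x y = 0 := by
  rw [Gate.op, of_apply, if_neg h]

/-- The inverse gate. -/
def Gate.inv {N : ℕ} (g : Gate N) : Gate N := ⟨g.fst, g.snd, g.ne, g.U⁻¹⟩

lemma Gate.inv_op {N : ℕ} (g : Gate N) : g.inv.op = g.opᴴ := by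
  ext x y
  have h : (∀ i, i ≠ g.fst → i ≠ g.snd → x i = y i) ↔
      ∀ i, i ≠ g.fst → i ≠ g.snd → y i = x i := by
    simp only [eq_comm]
  rw [conjTranspose_apply]
  by_cases hx : ∀ i, i ≠ g.fst → i ≠ g.snd → x i = y i
  · rw [g.inv.op_apply_of hx, g.op_apply_of (h.1 hx)]
    rfl
  · rw [g.inv.op_apply_of_not hx, g.op_apply_of_not fun h' => hx (h.2 h'), star_zero]

/-- The second overwriting of the two wires erases the first, so the product reduces to that of the
two small unitaries. -/
lemma Gate.isometry {N : ℕ} (g : Gate N) : g.opᴴ * g.op = 1 := by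
  rw [← g.inv_op, ext_iff_mulVec]
  intro φ
  rw [one_mulVec, ← mulVec_mulVec]
  funext x
  have hne := g.ne
  rw [Gate.op_mulVec]
  simp only [Gate.op_mulVec]
  have hU : (g.inv.U : Matrix (Bool × Bool) (Bool × Bool) ℂ) * g.U = 1 := by
    have : g.inv.U * g.U = 1 := by simp [Gate.inv]
    exact congrArg Subtype.val this
  have hupd : ∀ p q : Bool × Bool,
      Function.update (Function.update (Function.update (Function.update x g.fst p.1) g.snd p.2)
        g.fst q.1) g.snd q.2 = Function.update (Function.update x g.fst q.1) g.snd q.2 := by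
    intro p q
    funext i
    by_cases h2 : i = g.snd
    · subst h2; simp
    by_cases h1 : i = g.fst
    · subst h1; simp [hne]
    · simp [h1, h2]
  simp only [Gate.inv] at hU ⊢
  simp only [Function.update_self, Function.update_of_ne hne, hupd, Finset.mul_sum]
  rw [Finset.sum_comm]
  simp only [← mul_assoc, ← Finset.sum_mul]
  have : ∀ q : Bool × Bool, ∑ p : Bool × Bool,
      (↑(g.U⁻¹) : Matrix (Bool × Bool) (Bool × Bool) ℂ) (x g.fst, x g.snd) p *
      (g.U : Matrix (Bool × Bool) (Bool × Bool) ℂ) (p.1, p.2) q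
      = (1 : Matrix (Bool × Bool) (Bool × Bool) ℂ) (x g.fst, x g.snd) q := by
    intro q
    rw [← hU, mul_apply]
  simp only [this, one_apply, ite_mul, one_mul, zero_mul]
  simp

/-- The inverse circuit. -/
def circuitInv {N : ℕ} (C : Circuit N) : Circuit N := (C.map Gate.inv).reverse

lemma circuitOp_append {N : ℕ} (C D : Circuit N) :
    circuitOp (C ++ D) = circuitOp D * circuitOp C := by
  induction C with
  | nil => simp [circuitOp]
  | cons g C ih => simp [circuitOp, ih, mul_assoc]

lemma circuitOp_inv {N : ℕ} (C : Circuit N) : circuitOp (circuitInv C) = (circuitOp C)ᴴ := by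
  induction C with
  | nil => simp [circuitOp, circuitInv]
  | cons g C ih =>
    rw [circuitInv] at ih
    simp [circuitInv, circuitOp_append, ih, circuitOp, g.inv_op]

lemma circuitOp_isometry {N : ℕ} (C : Circuit N) : (circuitOp C)ᴴ * circuitOp C = 1 := by
  induction C with
  | nil => simp [circuitOp]
  | cons g C ih =>
    rw [circuitOp, conjTranspose_mul, mul_assoc, ← mul_assoc _ _ g.op, ih, one_mul, g.isometry]

/-- The diagonal two-qubit unitary with the phase `-1` on the basis states in `s`. -/
def phaseUnitary (s : Bool → Bool → Bool) : unitaryGroup (Bool × Bool) ℂ :=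
  ⟨diagonal fun p => if s p.1 p.2 = true then -1 else 1, by
    rw [mem_unitaryGroup_iff, star_eq_conjTranspose, diagonal_conjTranspose, diagonal_mul_diagonal,
      ← diagonal_one]
    congr 1
    funext p
    simp only [Pi.star_apply]
    split_ifs <;> simp⟩

/-- The gate with `phaseUnitary` on two wires. -/
def phaseGate {N : ℕ} (i j : Fin N) (h : i ≠ j) (s : Bool → Bool → Bool) : Gate N :=
  ⟨i, j, h, phaseUnitary s⟩

lemma phaseGate_mulVec {N : ℕ} (i j : Fin N) (h : i ≠ j) (s : Bool → Bool → Bool) (φ : Ket N)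
    (x : Bits N) :
    ((phaseGate i j h s).op *ᵥ φ) x = (if s (x i) (x j) = true then -1 else 1) * φ x := by
  rw [Gate.op_mulVec, Finset.sum_eq_single (x i, x j)]
  · simp [phaseGate, phaseUnitary]
  · intro p _ hp
    simp [phaseGate, phaseUnitary, diagonal_apply_ne' _ hp]
  · simp

/-- The two-qubit unitary acting as the Hadamard gate on the first qubit. -/
noncomputable def hadamardUnitary : unitaryGroup (Bool × Bool) ℂ :=
  ⟨of fun p q => if p.2 = q.2 then
      (if (p.1 && q.1) = true then -1 else 1) * (((Real.sqrt 2)⁻¹ : ℝ) : ℂ) else 0, by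
    have h : (((Real.sqrt 2)⁻¹ : ℝ) : ℂ) * (((Real.sqrt 2)⁻¹ : ℝ) : ℂ) = 1 / 2 := by
      rw [← Complex.ofReal_mul, ← mul_inv, Real.mul_self_sqrt (by norm_num)]
      norm_num
    rw [mem_unitaryGroup_iff]
    ext ⟨a, b⟩ ⟨c, d⟩
    generalize (((Real.sqrt 2)⁻¹ : ℝ)) = r at h
    cases a <;> cases b <;> cases c <;> cases d <;>
      simp [mul_apply, star_apply, Fintype.sum_prod_type, h] <;> norm_num⟩

/-- The Hadamard gate on wire `i`, with `j` an idle wire. -/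
noncomputable def hadamardGate {N : ℕ} (i j : Fin N) (h : i ≠ j) : Gate N :=
  ⟨i, j, h, hadamardUnitary⟩

lemma hadamardGate_mulVec {N : ℕ} (i j : Fin N) (h : i ≠ j) (φ : Ket N) (x : Bits N) :
    ((hadamardGate i j h).op *ᵥ φ) x = (((Real.sqrt 2)⁻¹ : ℝ) : ℂ) *
      (φ (Function.update x i false) +
        (if x i = true then -1 else 1) * φ (Function.update x i true)) := by
  have hu : ∀ c, Function.update (Function.update x i c) j (x j) = Function.update x i c := by
    intro c
    have : x j = Function.update x i c j := by simp [h.symm]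
    rw [this, Function.update_eq_self]
  rw [Gate.op_mulVec]
  simp only [hadamardGate, hadamardUnitary, Fintype.sum_prod_type, Fintype.sum_bool, of_apply]
  cases hj : x j <;> rw [hj] at hu <;> cases x i <;> simp [hu] <;> ring

/-! ### Two extra wires -/

/-- The control wire. -/
def ctl (N : ℕ) : Fin (N + 2) := (Fin.last N).castSucc

/-- The idle wire. -/
def idle (N : ℕ) : Fin (N + 2) := Fin.last (N + 1)

/-- An original wire. -/
def orig {N : ℕ} (i : Fin N) : Fin (N + 2) := i.castSucc.castSucc

/-- Every gate needs two distinct wires; the idle wire, which stays 0, is the partner for one-qubit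
gates on the control wire. -/
lemma ctl_ne_idle (N : ℕ) : ctl N ≠ idle N := (Fin.castSucc_lt_last _).ne

lemma orig_ne_idle {N : ℕ} (i : Fin N) : orig i ≠ idle N := (Fin.castSucc_lt_last _).ne

lemma orig_ne_ctl {N : ℕ} (i : Fin N) : orig i ≠ ctl N := fun h =>
  (Fin.castSucc_lt_last i).ne (Fin.castSucc_injective _ h)

lemma orig_injective {N : ℕ} : Function.Injective (orig (N := N)) := fun _ _ h =>
  Fin.castSucc_injective _ (Fin.castSucc_injective _ h)

/-- The vector `∑_c |φ c⟩ ⊗ |c⟩ ⊗ |0⟩`. -/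
def withControl {N : ℕ} (φ : Bool → Ket N) : Ket (N + 2) :=
  fun x => if x (idle N) = true then 0 else φ (x (ctl N)) (fun i => x (orig i))

lemma sum_bits_add_two {N : ℕ} (f : Bool → Bool → Bits N → ℝ) :
    ∑ x : Bits (N + 2), f (x (idle N)) (x (ctl N)) (fun i => x (orig i)) =
      ∑ d, ∑ c, ∑ y, f d c y := by
  rw [← (Fin.snocEquiv (n := N + 1) fun _ => Bool).sum_comp, Fintype.sum_prod_type]
  refine Finset.sum_congr rfl fun d _ => ?_
  rw [← (Fin.snocEquiv (n := N) fun _ => Bool).sum_comp, Fintype.sum_prod_type]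
  refine Finset.sum_congr rfl fun c _ => Finset.sum_congr rfl fun y _ => ?_
  simp [Fin.snocEquiv, idle, ctl, orig]

lemma sum_withControl_true {N : ℕ} (φ : Bool → Ket N) :
    (∑ x, if x (ctl N) = true then ‖withControl φ x‖ ^ 2 else 0) = nsq (φ true) := by
  refine (sum_bits_add_two fun d c y => if c = true then
    ‖(if d = true then (0 : ℂ) else φ c y)‖ ^ 2 else 0).trans ?_
  simp [nsq]

lemma nsq_withControl {N : ℕ} (φ : Bool → Ket N) :
    nsq (withControl φ) = nsq (φ true) + nsq (φ false) := by
  refine (sum_bits_add_two fun d c y => ‖(if d = true then (0 : ℂ) else φ c y)‖ ^ 2).trans ?_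
  simp [nsq]

/-- A gate on the original wires. -/
def Gate.lift {N : ℕ} (g : Gate N) : Gate (N + 2) :=
  ⟨orig g.fst, orig g.snd, fun h => g.ne (orig_injective h), g.U⟩

lemma Gate.lift_mulVec {N : ℕ} (g : Gate N) (φ : Bool → Ket N) :
    g.lift.op *ᵥ withControl φ = withControl fun c => g.op *ᵥ φ c := by
  funext x
  have h1 : ∀ p : Bool × Bool, Function.update (Function.update x (orig g.fst) p.1)
      (orig g.snd) p.2 (idle N) = x (idle N) := fun p => by
    simp [(orig_ne_idle _).symm]
  have h2 : ∀ p : Bool × Bool, Function.update (Function.update x (orig g.fst) p.1)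
      (orig g.snd) p.2 (ctl N) = x (ctl N) := fun p => by
    simp [(orig_ne_ctl _).symm]
  have h3 : ∀ p : Bool × Bool, (fun i => Function.update (Function.update x (orig g.fst) p.1)
      (orig g.snd) p.2 (orig i)) =
      Function.update (Function.update (fun i => x (orig i)) g.fst p.1) g.snd p.2 := fun p => by
    have e1 := Function.update_comp_eq_of_injective
      (Function.update x (orig g.fst) p.1) orig_injective g.snd p.2
    have e2 := Function.update_comp_eq_of_injective x orig_injective g.fst p.1
    simp only [Function.comp_def] at e1 e2
    rw [e1, e2]
  rw [Gate.op_mulVec]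
  simp only [withControl, Gate.lift, h1, h2, h3, Gate.op_mulVec]
  split_ifs <;> simp

/-- A circuit on the original wires. -/
def circuitLift {N : ℕ} (C : Circuit N) : Circuit (N + 2) := C.map Gate.lift

lemma circuitLift_mulVec {N : ℕ} (C : Circuit N) (φ : Bool → Ket N) :
    circuitOp (circuitLift C) *ᵥ withControl φ = withControl fun c => circuitOp C *ᵥ φ c := by
  induction C generalizing φ with
  | nil => simp [circuitLift, circuitOp]
  | cons g C ih =>
    have ih := fun φ => ih φ
    simp only [circuitLift] at ih
    simp [circuitLift, circuitOp, ← mulVec_mulVec, Gate.lift_mulVec, ih]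

/-- The diagonal operator with entries `(-1)^{x_r · m}`. -/
def signOp {l N : ℕ} (r : Fin l ↪ Fin N) (m : Bits l) : QOp N :=
  diagonal fun x => (-1) ^ dot (fun i => x (r i)) m

/-- `signOp`, controlled on the value `c` of the control wire satisfying `s c`. -/
def signLayer {l N : ℕ} (r : Fin l ↪ Fin N) (m : Bits l) (s : Bool → Bool) : Circuit (N + 2) :=
  List.ofFn fun i => phaseGate (orig (r i)) (ctl N) (orig_ne_ctl _)
    fun t c => (t && m i) && s c

lemma circuitOp_ofFn_phaseGate {N l : ℕ} (i j : Fin l → Fin N) (h : ∀ t, i t ≠ j t)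
    (s : Fin l → Bool → Bool → Bool) (φ : Ket N) (x : Bits N) :
    (circuitOp (List.ofFn fun t => phaseGate (i t) (j t) (h t) (s t)) *ᵥ φ) x =
      (∏ t, if s t (x (i t)) (x (j t)) = true then -1 else 1) * φ x := by
  induction l generalizing φ with
  | zero => simp [circuitOp]
  | succ l ih =>
    rw [List.ofFn_succ, circuitOp, ← mulVec_mulVec,
      ih (fun t => i t.succ) (fun t => j t.succ) (fun t => h t.succ) (fun t => s t.succ),
      phaseGate_mulVec, Fin.prod_univ_succ]
    ring

lemma signLayer_mulVec {l N : ℕ} (r : Fin l ↪ Fin N) (m : Bits l) (s : Bool → Bool)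
    (φ : Bool → Ket N) :
    circuitOp (signLayer r m s) *ᵥ withControl φ =
      withControl fun c => if s c = true then signOp r m *ᵥ φ c else φ c := by
  funext x
  rw [signLayer, circuitOp_ofFn_phaseGate]
  by_cases hi : x (idle N) = true
  · simp [withControl, hi]
  · simp only [withControl, hi]
    by_cases hs : s (x (ctl N)) = true
    · simp [hs, signOp, mulVec_diagonal, neg_one_pow_dot]
    · simp [hs]

/-- The Hadamard gate on the control wire. -/
noncomputable def ctlHadamard (N : ℕ) : Circuit (N + 2) := [hadamardGate (ctl N) (idle N) (ctl_ne_idle N)]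

lemma ctlHadamard_mulVec {N : ℕ} (φ : Bool → Ket N) :
    circuitOp (ctlHadamard N) *ᵥ withControl φ = withControl fun c =>
      (((Real.sqrt 2)⁻¹ : ℝ) : ℂ) • (φ false + (if c = true then (-1 : ℂ) else 1) • φ true) := by
  funext x
  have h3 : ∀ c, (fun i => Function.update x (ctl N) c (orig i)) = fun i => x (orig i) :=
    fun c => by funext i; simp [orig_ne_ctl]
  rw [ctlHadamard, circuitOp, circuitOp, one_mul, hadamardGate_mulVec]
  by_cases hi : x (idle N) = true
  · simp [withControl, hi, (ctl_ne_idle N).symm]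
  · simp only [withControl, hi, h3]
    cases x (ctl N) <;> simp [hi, (ctl_ne_idle N).symm]

/-- The phase `-1` on the value `1` of the control wire, if `σ` holds. -/
def ctlSign (N : ℕ) (σ : Bool) : Circuit (N + 2) :=
  [phaseGate (ctl N) (idle N) (ctl_ne_idle N) fun c _ => c && σ]

lemma ctlSign_mulVec {N : ℕ} (σ : Bool) (φ : Bool → Ket N) :
    circuitOp (ctlSign N σ) *ᵥ withControl φ =
      withControl fun c => (if (c && σ) = true then (-1 : ℂ) else 1) • φ c := by
  funext x
  rw [ctlSign, circuitOp, circuitOp, one_mul, phaseGate_mulVec]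
  by_cases hi : x (idle N) = true
  · simp [withControl, hi]
  · simp [withControl, hi]

lemma loadKet_withControl {l w : ℕ} (c : Bits l) (ψ : Ket w) :
    loadKet c (withControl fun d => if d = true then 0 else ψ) =
      withControl fun d => if d = true then 0 else loadKet c ψ := by
  funext x
  have e1 : x (Fin.natAdd l (idle w)) = x (idle (l + w)) := rfl
  have e2 : x (Fin.natAdd l (ctl w)) = x (ctl (l + w)) := rfl
  have e3 : (∀ i, x (Fin.castAdd (w + 2) i) = c i) ↔
      ∀ i, x (orig (Fin.castAdd w i)) = c i := Iff.rfl
  simp only [loadKet, withControl, e1, e2, e3]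
  cases x (idle (l + w)) <;> cases x (ctl (l + w)) <;> simp
  rfl

/-! ### Measurements of wires -/

lemma nsq_readProj {l N : ℕ} (r : Fin l ↪ Fin N) (s : Bits l) (v : Ket N) :
    nsq (readProj r s *ᵥ v) = ∑ x, if (fun i => x (r i)) = s then ‖v x‖ ^ 2 else 0 := by
  unfold nsq readProj
  refine Finset.sum_congr rfl fun x _ => ?_
  rw [mulVec_diagonal]
  simp only [funext_iff]
  split_ifs <;> simp

lemma nsq_diagonal_comp {l N : ℕ} (r : Fin l ↪ Fin N) (f : Bits l → ℂ) (v : Ket N) :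
    nsq (diagonal (fun x : Bits N => f fun i => x (r i)) *ᵥ v) =
      ∑ s, ‖f s‖ ^ 2 * nsq (readProj r s *ᵥ v) := by
  simp only [nsq_readProj, Finset.mul_sum]
  rw [Finset.sum_comm]
  refine Finset.sum_congr rfl fun x _ => ?_
  simp [mulVec_diagonal, mul_pow]

lemma sum_nsq_readProj {l N : ℕ} (r : Fin l ↪ Fin N) (v : Ket N) :
    ∑ s, nsq (readProj r s *ᵥ v) = nsq v := by
  have h := nsq_diagonal_comp r (fun _ => 1) v
  simp only [diagonal_one, one_mulVec] at h
  simp [h]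

lemma sum_smul_readProj {l N : ℕ} (r : Fin l ↪ Fin N) (f : Bits l → ℂ) :
    ∑ s, f s • readProj r s = diagonal fun x : Bits N => f fun i => x (r i) := by
  classical
  ext x y
  rw [Matrix.sum_apply]
  by_cases h : x = y
  · subst h
    simp only [readProj, Matrix.smul_apply, diagonal_apply_eq, ← funext_iff]
    simp
  · simp [readProj, h]

lemma signOp_eq_sum {l N : ℕ} (r : Fin l ↪ Fin N) (m : Bits l) :
    signOp r m = ∑ s, (-1 : ℂ) ^ dot s m • readProj r s :=
  (sum_smul_readProj r fun s => (-1 : ℂ) ^ dot s m).symm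

lemma signOp_mul_self {l N : ℕ} (r : Fin l ↪ Fin N) (m : Bits l) :
    signOp r m * signOp r m = 1 := by
  rw [signOp, diagonal_mul_diagonal, ← diagonal_one]
  congr 1
  funext x
  exact neg_one_pow_mul_self _

lemma signOp_conjTranspose {l N : ℕ} (r : Fin l ↪ Fin N) (m : Bits l) :
    (signOp r m)ᴴ = signOp r m := by
  rw [signOp, diagonal_conjTranspose]
  congr 1
  funext x
  simp

lemma readProj_isProj {l N : ℕ} (r : Fin l ↪ Fin N) (s : Bits l) :
    (readProj r s)ᴴ * readProj r s = readProj r s := by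
  rw [readProj, diagonal_conjTranspose, diagonal_mul_diagonal]
  congr 1
  funext x
  simp only [Pi.star_apply]
  split_ifs <;> simp

/-- Measuring wires and forgetting the outcome is the same as applying random phases. -/
lemma sum_nsq_mulVec_readProj {l N : ℕ} (r : Fin l ↪ Fin N) (A : QOp N) (v : Ket N) :
    2 ^ l * ∑ α, nsq (A *ᵥ (readProj r α *ᵥ v)) = ∑ z, nsq (A *ᵥ (signOp r z *ᵥ v)) := by
  unfold nsq
  rw [Finset.sum_comm, Finset.sum_comm (s := univ (α := Bits l)), Finset.mul_sum]
  refine Finset.sum_congr rfl fun x _ => ?_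
  rw [← sum_norm_sq_sum_sign]
  refine Finset.sum_congr rfl fun z _ => ?_
  rw [signOp_eq_sum, sum_mulVec, mulVec_sum, Finset.sum_apply]
  simp [smul_mulVec, mulVec_smul]

lemma nsq_loadKet {l w : ℕ} (c : Bits l) (ψ : Ket w) : nsq (loadKet c ψ) = nsq ψ := by
  unfold nsq
  rw [← (Fin.appendEquiv (α := Bool) l w).sum_comp, Fintype.sum_prod_type,
    Finset.sum_eq_single c]
  · simp [loadKet, Fin.appendEquiv]
  · intro b _ hb
    refine Finset.sum_eq_zero fun y _ => ?_
    rw [loadKet, if_neg, norm_zero, zero_pow two_ne_zero]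
    intro h
    exact hb (funext fun i => by simpa [Fin.appendEquiv] using h i)
  · simp

lemma Advice.Allows.nsq_eq_one {adv : Advice} {w : ℕ} {ψ : Ket w} (h : adv.Allows ψ) :
    nsq ψ = 1 := by
  cases adv with
  | classical =>
    rw [show ψ = Pi.single (fun _ => false) 1 from h, nsq, Finset.sum_eq_single fun _ => false]
    · simp
    · intro b _ hb; simp [hb]
    · simp
  | quantum => exact h

/-- Two extra qubits in state 0 are harmless under either convention for advice, so the reduction to
security works for both. -/
lemma Advice.Allows.withControl {adv : Advice} {w : ℕ} {ψ : Ket w} (h : adv.Allows ψ) :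
    adv.Allows (withControl fun d => if d = true then 0 else ψ) := by
  have h1 := h.nsq_eq_one
  cases adv with
  | classical =>
    have hψ : ψ = Pi.single (fun _ => false) 1 := h
    change PauliBraiding.withControl _ = _
    funext x
    by_cases hx : x = fun _ => false
    · subst hx
      simp [PauliBraiding.withControl, hψ]
    · rw [Pi.single_eq_of_ne hx]
      simp only [PauliBraiding.withControl]
      split_ifs with h1 h2
      · rfl
      · rfl
      · rw [hψ, Pi.single_eq_of_ne]
        intro h3
        apply hx
        funext i
        refine Fin.lastCases ?_ (fun j => Fin.lastCases ?_ (fun t => ?_) j) i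
        · simpa [idle] using h1
        · simpa [ctl] using h2
        · exact congrFun h3 t
  | quantum =>
    change nsq _ = 1
    rw [nsq_withControl]
    simpa using h1

lemma pmf_sum_toReal {α : Type*} [Fintype α] (p : PMF α) : ∑ a, (p a).toReal = 1 := by
  rw [← ENNReal.toReal_sum fun a _ => p.apply_ne_top a, ← tsum_fintype (L := .unconditional _), p.tsum_coe,
    ENNReal.toReal_one]

/-! ### Averages over the first round -/

/-- An observable of Bob: the question, and the mask of the answer bits whose parity is taken. -/
abbrev Setup.Letter {E : EncryptionScheme} (G : Setup E) (k : ℕ) : Type :=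
  Σ y : BobQuestion (G.S k), Bits y.ansLen

namespace Prover

variable {E : EncryptionScheme} {G : Setup E} (P : Prover G) (k : ℕ)

/-- The observable of a letter. -/
noncomputable def letterOp (x : G.Letter k) : QOp (E.ctLen k + P.work k) :=
  ∑ v, (-1 : ℂ) ^ dot v x.2 • P.bobMeas k x.1 v

lemma obs_eq_letterOp (W : Basis) (a : Bits (G.n k)) :
    P.obs k W a = P.letterOp k ⟨.basis W, a⟩ := rfl

lemma letterOp_eq (x : G.Letter k) :
    P.letterOp k x = (circuitOp (P.bobCircuit k x.1))ᴴ * signOp (P.bobOut k x.1) x.2 *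
      circuitOp (P.bobCircuit k x.1) := by
  rw [signOp_eq_sum, letterOp, Finset.mul_sum, Finset.sum_mul]
  refine Finset.sum_congr rfl fun v _ => ?_
  rw [bobMeas, mul_smul_comm, smul_mul_assoc]

lemma letterOp_isometry (x : G.Letter k) : (P.letterOp k x)ᴴ * P.letterOp k x = 1 := by
  have h2 := mul_eq_one_comm.1 (circuitOp_isometry (P.bobCircuit k x.1))
  rw [letterOp_eq]
  simp only [conjTranspose_mul, conjTranspose_conjTranspose, signOp_conjTranspose, mul_assoc]
  rw [← mul_assoc _ _ (signOp (P.bobOut k x.1) x.2 * circuitOp (P.bobCircuit k x.1)), h2, one_mul,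
    ← mul_assoc (signOp _ _), signOp_mul_self, one_mul, circuitOp_isometry]

lemma nsq_letterOp (x : G.Letter k) (v : Ket (E.ctLen k + P.work k)) :
    nsq (P.letterOp k x *ᵥ v) = nsq v :=
  nsq_mulVec_of_isometry (P.letterOp_isometry k x) v

/-- The squared norm of the part of `v` with outcome `s` of Bob's measurement. -/
noncomputable def mass (y : BobQuestion (G.S k)) (s : Bits y.ansLen)
    (v : Ket (E.ctLen k + P.work k)) : ℝ :=
  nsq (readProj (P.bobOut k y) s *ᵥ (circuitOp (P.bobCircuit k y) *ᵥ v))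

lemma mass_nonneg (y : BobQuestion (G.S k)) (s : Bits y.ansLen)
    (v : Ket (E.ctLen k + P.work k)) : 0 ≤ P.mass k y s v := nsq_nonneg _

lemma sum_mass (y : BobQuestion (G.S k)) (v : Ket (E.ctLen k + P.work k)) :
    ∑ s, P.mass k y s v = nsq v := by
  simp only [mass]
  rw [sum_nsq_readProj, nsq_mulVec_of_isometry (circuitOp_isometry _)]

lemma trace_bobMeas_mul_ketbra (y : BobQuestion (G.S k)) (s : Bits y.ansLen)
    (v : Ket (E.ctLen k + P.work k)) :
    (trace (P.bobMeas k y s * ketbra v)).re = P.mass k y s v := by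
  rw [trace_mul_ketbra, mass, mulVec_mulVec]
  have h := nsq_mulVec (readProj (P.bobOut k y) s * circuitOp (P.bobCircuit k y)) v
  rw [conjTranspose_mul, mul_assoc, ← mul_assoc _ _ (circuitOp _), readProj_isProj,
    ← mul_assoc] at h
  rw [bobMeas, ← h, Complex.ofReal_re]

/-- The letter is diagonal in the basis that Bob measures, so its deviation from a scalar is a
weighted sum over his outcomes. This links operator distances to winning probabilities and, later,
to the bias of `S`. -/
lemma nsq_letterOp_sub_smul (x : G.Letter k) (t : ℂ) (v : Ket (E.ctLen k + P.work k)) :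
    nsq (P.letterOp k x *ᵥ v - t • v) =
      ∑ s, ‖(-1 : ℂ) ^ dot s x.2 - t‖ ^ 2 * P.mass k x.1 s v := by
  have h1 := circuitOp_isometry (P.bobCircuit k x.1)
  have h2 := mul_eq_one_comm.1 h1
  have e : P.letterOp k x *ᵥ v - t • v = (circuitOp (P.bobCircuit k x.1))ᴴ *ᵥ
      (diagonal (fun z : Bits _ => (-1 : ℂ) ^ dot (fun i => z (P.bobOut k x.1 i)) x.2 - t) *ᵥ
        (circuitOp (P.bobCircuit k x.1) *ᵥ v)) := by
    have : diagonal (fun z : Bits _ => (-1 : ℂ) ^ dot (fun i => z (P.bobOut k x.1 i)) x.2 - t) =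
        signOp (P.bobOut k x.1) x.2 - t • 1 := by
      rw [signOp, ← diagonal_one, ← diagonal_smul, diagonal_sub]
      congr 1
      funext z
      simp
    rw [this, mulVec_mulVec, mulVec_mulVec, letterOp_eq, mul_sub, sub_mul, sub_mulVec,
      mul_smul_comm, smul_mul_assoc, mul_one, h1, smul_mulVec, one_mulVec]
  rw [e, nsq_mulVec_of_isometry (by rwa [conjTranspose_conjTranspose]),
    nsq_diagonal_comp (P.bobOut k x.1) fun s => (-1 : ℂ) ^ dot s x.2 - t]
  rfl

/-- The average over the key, the ciphertext of `q`, and the sum over Alice's outcomes. -/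
noncomputable def avg (q : AliceQuestion (G.S k))
    (F : Bits (E.keyLen k) → Bits (E.ctLen k) → Bits (P.aliceLen k) → ℝ) : ℝ :=
  ∑ sk, (E.gen k sk).toReal * ∑ c, (E.enc k sk (G.encode k q) c).toReal * ∑ α, F sk c α

variable {k} {q : AliceQuestion (G.S k)}
  {F F' : Bits (E.keyLen k) → Bits (E.ctLen k) → Bits (P.aliceLen k) → ℝ}

lemma avg_mono (h : ∀ sk c α, F sk c α ≤ F' sk c α) : P.avg k q F ≤ P.avg k q F' := by
  unfold avg
  gcongr
  exact h _ _ _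

lemma avg_add : P.avg k q (fun sk c α => F sk c α + F' sk c α) =
    P.avg k q F + P.avg k q F' := by
  simp [avg, Finset.sum_add_distrib, mul_add]

lemma avg_sub : P.avg k q (fun sk c α => F sk c α - F' sk c α) =
    P.avg k q F - P.avg k q F' := by
  simp [avg, Finset.sum_sub_distrib, mul_sub]

lemma avg_const_mul (t : ℝ) : P.avg k q (fun sk c α => t * F sk c α) = t * P.avg k q F := by
  simp only [avg, Finset.mul_sum]
  refine Finset.sum_congr rfl fun _ _ => Finset.sum_congr rfl fun _ _ =>
    Finset.sum_congr rfl fun _ _ => by ring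

lemma avg_sum {ι : Type*} (s : Finset ι)
    (F : ι → Bits (E.keyLen k) → Bits (E.ctLen k) → Bits (P.aliceLen k) → ℝ) :
    P.avg k q (fun sk c α => ∑ i ∈ s, F i sk c α) = ∑ i ∈ s, P.avg k q (F i) := by
  classical
  induction s using Finset.induction_on with
  | empty => simp [avg]
  | insert i s hi ih =>
    simp only [Finset.sum_insert hi]
    rw [avg_add, ih]

variable (k) (q)

lemma stateNormSq_encState (A : QOp (E.ctLen k + P.work k)) :
    stateNormSq A (P.encState k q) =
      P.avg k q fun _ c α => nsq (A *ᵥ P.postKet k c α) := by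
  simp only [← stateNormSq_ketbra]
  simp only [stateNormSq, encState, avg, Finset.mul_sum, mul_smul_comm, trace_sum, trace_smul,
    Complex.re_sum, smul_eq_mul, Complex.re_ofReal_mul]

lemma roundWin_eq (y : BobQuestion (G.S k)) (V : List Bool → Bits y.ansLen → Prop)
    [∀ u v, Decidable (V u v)] :
    P.roundWin k q y V = P.avg k q fun sk c α => ∑ b,
      if V (E.dec k sk (List.ofFn α)) b then P.mass k y b (P.postKet k c α) else 0 := by
  simp only [roundWin, avg, trace_bobMeas_mul_ketbra]

lemma avg_nsq_postKet (hP : nsq (P.init k) = 1) :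
    P.avg k q (fun _ c α => nsq (P.postKet k c α)) = 1 := by
  simp only [avg, postKet, sum_nsq_readProj, nsq_mulVec_of_isometry (circuitOp_isometry _),
    nsq_loadKet, hP, mul_one, pmf_sum_toReal]

/-- If the predicate determines the sign of a letter from Alice's answer, then the letter acts
on the state as this sign, up to the losing probability. -/
lemma avg_letterOp_sub_le (hP : nsq (P.init k) = 1) (x : G.Letter k)
    (V : List Bool → Bits x.1.ansLen → Prop) (t : List Bool → ℂ) (ht : ∀ u, ‖t u‖ = 1)
    (hV : ∀ u v, V u v → (-1 : ℂ) ^ dot v x.2 = t u) :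
    P.avg k q (fun sk c α => nsq (P.letterOp k x *ᵥ P.postKet k c α -
      t (E.dec k sk (List.ofFn α)) • P.postKet k c α)) ≤ 4 * (1 - P.roundWin k q x.1 V) := by
  classical
  rw [← P.avg_nsq_postKet k q hP, roundWin_eq, ← avg_sub, ← avg_const_mul]
  refine P.avg_mono fun sk c α => ?_
  rw [nsq_letterOp_sub_smul, ← P.sum_mass k x.1, ← Finset.sum_sub_distrib, Finset.mul_sum]
  refine Finset.sum_le_sum fun s _ => ?_
  -- A winning outcome costs nothing, a losing one at most `2 ^ 2` times its weight.
  split_ifs with h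
  · simp [hV _ _ h]
  · rw [sub_zero]
    refine mul_le_mul_of_nonneg_right ?_ (P.mass_nonneg _ _ _ _)
    have h1 : ‖(-1 : ℂ) ^ dot s x.2 - t (E.dec k sk (List.ofFn α))‖ ≤ 2 := by
      refine (norm_sub_le _ _).trans ?_
      rw [ht, norm_neg_one_pow]; norm_num
    nlinarith [norm_nonneg ((-1 : ℂ) ^ dot s x.2 - t (E.dec k sk (List.ofFn α)))]

lemma roundWin_le_one (hP : nsq (P.init k) = 1) (y : BobQuestion (G.S k))
    (V : List Bool → Bits y.ansLen → Prop) : P.roundWin k q y V ≤ 1 := by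
  classical
  rw [← P.avg_nsq_postKet k q hP, roundWin_eq]
  refine P.avg_mono fun sk c α => ?_
  rw [← P.sum_mass k y]
  refine Finset.sum_le_sum fun s _ => ?_
  split_ifs
  · exact le_rfl
  · exact P.mass_nonneg _ _ _ _

end Prover

/-! ### State switching -/

/-- Security treats one family of tests at a time. Choosing for each security parameter a test
within a factor 2 of the supremum makes the bound uniform without having to attain the supremum. -/
lemma exists_forall_le_two_mul {ι : Type*} [Nonempty ι] (f : ι → ℝ) (h0 : ∀ i, 0 ≤ f i)
    (h1 : ∀ i, f i ≤ 1) : ∃ i, ∀ j, f j ≤ 2 * f i := by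
  have hb : BddAbove (Set.range f) := ⟨1, by rintro _ ⟨i, rfl⟩; exact h1 i⟩
  by_cases h : ∀ j, f j = 0
  · exact ⟨Classical.arbitrary ι, fun j => by simp [h]⟩
  · push Not at h
    obtain ⟨i₀, hi₀⟩ := h
    have hpos : 0 < ⨆ i, f i :=
      lt_of_lt_of_le (lt_of_le_of_ne (h0 i₀) (Ne.symm hi₀)) (le_ciSup hb i₀)
    obtain ⟨i, hi⟩ := exists_lt_of_lt_ciSup (half_lt_self hpos)
    exact ⟨i, fun j => (le_ciSup hb j).trans (by linarith)⟩

namespace Prover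

variable {E : EncryptionScheme} {G : Setup E} (P : Prover G) (k : ℕ)

/-- The product of the observables of the letters of a word. -/
noncomputable def wordOp (l : List (G.Letter k)) : QOp (E.ctLen k + P.work k) :=
  (l.map (P.letterOp k)).prod

/-- The observable of a letter, controlled on the value `β` of the control wire. -/
def letterCircuit (β : Bool) (x : G.Letter k) : Circuit (E.ctLen k + P.work k + 2) :=
  circuitLift (P.bobCircuit k x.1) ++ (signLayer (P.bobOut k x.1) x.2 (fun c => c == β) ++
    circuitLift (circuitInv (P.bobCircuit k x.1)))

/-- The operator of a word, controlled on the value `β` of the control wire. -/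
def wordCircuit (β : Bool) : List (G.Letter k) → Circuit (E.ctLen k + P.work k + 2)
  | [] => []
  | x :: l => wordCircuit β l ++ P.letterCircuit k β x

variable {k}

/-- Only the diagonal layer is controlled, which keeps all gates on two wires; when the control is
off, Bob's circuit and its inverse cancel. -/
lemma letterCircuit_mulVec (β : Bool) (x : G.Letter k)
    (φ : Bool → Ket (E.ctLen k + P.work k)) :
    circuitOp (P.letterCircuit k β x) *ᵥ withControl φ =
      withControl fun c => if c = β then P.letterOp k x *ᵥ φ c else φ c := by
  rw [letterCircuit, circuitOp_append, circuitOp_append, ← mulVec_mulVec, ← mulVec_mulVec,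
    circuitLift_mulVec, signLayer_mulVec, circuitLift_mulVec]
  congr 1
  funext c
  rw [circuitOp_inv, letterOp_eq]
  by_cases h : c = β
  · simp [h, mulVec_mulVec, mul_assoc]
  · simp [h, mulVec_mulVec, circuitOp_isometry]

lemma wordCircuit_mulVec (β : Bool) (l : List (G.Letter k))
    (φ : Bool → Ket (E.ctLen k + P.work k)) :
    circuitOp (P.wordCircuit k β l) *ᵥ withControl φ =
      withControl fun c => if c = β then P.wordOp k l *ᵥ φ c else φ c := by
  induction l with
  | nil => simp [wordCircuit, wordOp, circuitOp]
  | cons x l ih =>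
    rw [wordCircuit, circuitOp_append, ← mulVec_mulVec, ih, letterCircuit_mulVec]
    congr 1
    funext c
    by_cases h : c = β <;> simp [h, wordOp]

lemma length_wordCircuit_le (β : Bool) (l : List (G.Letter k)) (B : ℕ)
    (hB : ∀ y, (P.bobCircuit k y).length ≤ B) :
    (P.wordCircuit k β l).length ≤ l.length * (2 * B + (E.ctLen k + P.work k)) := by
  induction l with
  | nil => simp [wordCircuit]
  | cons x l ih =>
    have h1 := hB x.1
    -- The sign layer has one gate per answer bit, and these bits are read off distinct wires.
    have h2 : x.1.ansLen ≤ E.ctLen k + P.work k := by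
      simpa using Fintype.card_le_of_embedding (P.bobOut k x.1)
    simp only [wordCircuit, letterCircuit, circuitLift, circuitInv, signLayer, List.length_append,
      List.length_map, List.length_reverse, List.length_ofFn, List.length_cons]
    rw [add_one_mul]
    omega

/-- The data of a Hadamard test comparing two words up to a sign, after the phase `z` on the wires
that Alice measures. -/
structure Test (k : ℕ) where
  left : List (G.Letter k)
  right : List (G.Letter k)
  neg : Bool
  phase : Bits (P.aliceLen k)

/-- The circuit of a Hadamard test. -/
noncomputable def testCircuit (T : P.Test k) : Circuit (E.ctLen k + P.work k + 2) :=
  circuitLift (P.aliceCircuit k) ++ (signLayer (P.aliceOut k) T.phase (fun _ => true) ++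
    (ctlHadamard _ ++ (P.wordCircuit k false T.left ++ (P.wordCircuit k true T.right ++
      (ctlSign _ T.neg ++ ctlHadamard _)))))

/-- The probability that the Hadamard test outputs `1` on ciphertext `c`. -/
noncomputable def testOn (T : P.Test k) (c : Bits (E.ctLen k)) : ℝ :=
  nsq ((P.wordOp k T.left - (if T.neg = true then (-1 : ℂ) else 1) • P.wordOp k T.right) *ᵥ
    (signOp (P.aliceOut k) T.phase *ᵥ
      (circuitOp (P.aliceCircuit k) *ᵥ loadKet c (P.init k)))) / 4

/-- The adversary executing a Hadamard test for each security parameter. -/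
noncomputable def testAdversary (T : ∀ k, P.Test k) : Adversary E where
  work k := P.work k + 2
  init k := withControl fun d => if d = true then 0 else P.init k
  circuit k := P.testCircuit (T k)
  out k := ctl (E.ctLen k + P.work k)

/-- This is the Hadamard test: the two branches of the control carry the two words, and the final
Hadamard gate leaves half their signed difference in the branch 1. -/
lemma testCircuit_mulVec (T : P.Test k) (φ : Ket (E.ctLen k + P.work k)) :
    ∃ ψ : Bool → Ket (E.ctLen k + P.work k),
      circuitOp (P.testCircuit T) *ᵥ (withControl fun d => if d = true then 0 else φ) =
        withControl ψ ∧
      nsq (ψ true) = nsq ((P.wordOp k T.left -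
        (if T.neg = true then (-1 : ℂ) else 1) • P.wordOp k T.right) *ᵥ
          (signOp (P.aliceOut k) T.phase *ᵥ (circuitOp (P.aliceCircuit k) *ᵥ φ))) / 4 := by
  -- Rewriting one side of a reflexive equation computes the final vector, so that `ψ` can be found
  -- by unification.
  have key := Eq.refl (circuitOp (P.testCircuit T) *ᵥ
    (withControl fun d => if d = true then 0 else φ))
  conv_rhs at key => rw [testCircuit]
  conv_rhs at key =>
    simp only [circuitOp_append, ← mulVec_mulVec, circuitLift_mulVec, signLayer_mulVec,
      ctlHadamard_mulVec, wordCircuit_mulVec, ctlSign_mulVec]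
  refine ⟨_, key, ?_⟩
  have e : (((Real.sqrt 2)⁻¹ : ℝ) : ℂ) * (((Real.sqrt 2)⁻¹ : ℝ) : ℂ) = 1 / 2 := by
    rw [← Complex.ofReal_mul, ← mul_inv, Real.mul_self_sqrt (by norm_num)]
    norm_num
  generalize (((Real.sqrt 2)⁻¹ : ℝ) : ℂ) = r at e
  have h : ∀ w : Ket (E.ctLen k + P.work k), nsq w / 4 = nsq ((1 / 2 : ℂ) • w) := by
    intro w
    rw [nsq_smul]
    norm_num
    ring
  rw [h, ← e]
  congr 1
  cases T.neg <;> simp [mulVec_smul, smul_smul, sub_eq_add_neg] <;>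
    simp only [add_mul, neg_mul, add_mulVec, neg_mulVec, smul_add, smul_neg]

lemma testAdversary_acceptOn (T : ∀ k, P.Test k) (k : ℕ) (c : Bits (E.ctLen k)) :
    (P.testAdversary T).acceptOn k c = P.testOn (T k) c := by
  obtain ⟨ψ, h1, h2⟩ := P.testCircuit_mulVec (T k) (loadKet c (P.init k))
  rw [testOn, ← h2, ← sum_withControl_true, ← h1, ← loadKet_withControl]
  rfl

lemma testOn_nonneg (T : P.Test k) (c : Bits (E.ctLen k)) : 0 ≤ P.testOn T c :=
  div_nonneg (nsq_nonneg _) (by norm_num)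

lemma nsq_wordOp (l : List (G.Letter k)) (v : Ket (E.ctLen k + P.work k)) :
    nsq (P.wordOp k l *ᵥ v) = nsq v := by
  induction l with
  | nil => simp [wordOp]
  | cons x l ih =>
    have : P.wordOp k (x :: l) = P.letterOp k x * P.wordOp k l := by simp [wordOp]
    rw [this, ← mulVec_mulVec, nsq_letterOp, ih]

lemma testOn_le_one (hP : nsq (P.init k) = 1) (T : P.Test k) (c : Bits (E.ctLen k)) :
    P.testOn T c ≤ 1 := by
  have hs : (signOp (P.aliceOut k) T.phase)ᴴ * signOp (P.aliceOut k) T.phase = 1 := by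
    rw [signOp_conjTranspose, signOp_mul_self]
  rw [testOn, sub_eq_add_neg, add_mulVec, div_le_one (by norm_num)]
  refine (nsq_add_le _ _).trans ?_
  rw [neg_mulVec, nsq_neg, smul_mulVec, nsq_smul, nsq_wordOp, nsq_wordOp,
    nsq_mulVec_of_isometry hs, nsq_mulVec_of_isometry (circuitOp_isometry _), nsq_loadKet, hP]
  split_ifs <;> norm_num

/-- The probability that the Hadamard test outputs `1` on an encryption of `q`. -/
noncomputable def test (T : P.Test k) (q : AliceQuestion (G.S k)) : ℝ :=
  ∑ sk, (E.gen k sk).toReal * ∑ c, (E.enc k sk (G.encode k q) c).toReal * P.testOn T c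

lemma testAdversary_accept (T : ∀ k, P.Test k) (k : ℕ) (q : AliceQuestion (G.S k)) :
    (P.testAdversary T).accept k (G.encode k q) = P.test (T k) q := by
  simp only [Adversary.accept, test, testAdversary_acceptOn]

lemma test_nonneg (T : P.Test k) (q : AliceQuestion (G.S k)) : 0 ≤ P.test T q :=
  Finset.sum_nonneg fun _ _ => mul_nonneg ENNReal.toReal_nonneg <|
    Finset.sum_nonneg fun _ _ => mul_nonneg ENNReal.toReal_nonneg (P.testOn_nonneg T _)

lemma test_le_one (hP : nsq (P.init k) = 1) (T : P.Test k) (q : AliceQuestion (G.S k)) :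
    P.test T q ≤ 1 := by
  calc P.test T q ≤ ∑ sk, (E.gen k sk).toReal *
        ∑ c, (E.enc k sk (G.encode k q) c).toReal * 1 := by
        unfold test
        gcongr
        exact P.testOn_le_one hP T _
    _ = 1 := by simp only [mul_one, pmf_sum_toReal]

lemma testAdversary_efficient {adv : Advice} (hP : P.Efficient adv) (T : ∀ k, P.Test k)
    (h1 : ∀ k, (T k).left.length ≤ 3) (h2 : ∀ k, (T k).right.length ≤ 3) :
    (P.testAdversary T).Efficient adv := by
  obtain ⟨hinit, p, hp⟩ := hP
  -- Two words of at most three letters, each with at most `3p` gates, give `18p`; the wires and the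
  -- other gates add at most `2p + 5`.
  refine ⟨fun k => (hinit k).withControl, Polynomial.C 22 * p + Polynomial.C 5, fun k => ?_⟩
  obtain ⟨h3, h4⟩ := hp k
  have h5 := (P.length_wordCircuit_le false (T k).left _ h4).trans
    (Nat.mul_le_mul_right _ (h1 k))
  have h6 := (P.length_wordCircuit_le true (T k).right _ h4).trans
    (Nat.mul_le_mul_right _ (h2 k))
  have h7 : P.aliceLen k ≤ E.ctLen k + P.work k := by
    simpa using Fintype.card_le_of_embedding (P.aliceOut k)
  simp only [testAdversary, testCircuit, circuitLift, signLayer, ctlHadamard, ctlSign,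
    List.length_append, List.length_map, List.length_ofFn, List.length_cons, List.length_nil,
    Polynomial.eval_add, Polynomial.eval_mul, Polynomial.eval_C]
  omega

/-- Alice's measurement is traded for random phases on the measured wires. Each fixed phase `z`
gives a unitary circuit, so no measurement in mid-circuit is needed. -/
lemma stateNormSq_encState_eq_sum_test (U V : List (G.Letter k)) (σ : Bool)
    (q : AliceQuestion (G.S k)) :
    2 ^ P.aliceLen k * stateNormSq
      (P.wordOp k U - (if σ = true then (-1 : ℂ) else 1) • P.wordOp k V) (P.encState k q) =
      4 * ∑ z, P.test ⟨U, V, σ, z⟩ q := by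
  rw [stateNormSq_encState]
  simp only [avg, postKet, test, testOn]
  simp only [Finset.mul_sum]
  rw [Finset.sum_comm (s := univ (α := Bits (P.aliceLen k)))]
  refine Finset.sum_congr rfl fun sk _ => ?_
  rw [Finset.sum_comm (s := univ (α := Bits (P.aliceLen k)))]
  refine Finset.sum_congr rfl fun c _ => ?_
  simp only [← Finset.mul_sum]
  rw [mul_left_comm, mul_left_comm (2 ^ _ : ℝ), sum_nsq_mulVec_readProj]
  simp only [Finset.mul_sum]
  refine Finset.sum_congr rfl fun z _ => ?_
  ring

/-- The state-dependent distance of two short words of Bob's observables hardly depends on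
the encrypted question. -/
theorem exists_negligible_switch {adv : Advice} (hE : E.Secure adv) (hP : P.Efficient adv) :
    ∃ ν : ℕ → ℝ, Negligible ν ∧ (∀ k, 0 ≤ ν k) ∧
      ∀ (k : ℕ) (U V : List (G.Letter k)) (s : ℂ), U.length ≤ 3 → V.length ≤ 3 →
        (s = 1 ∨ s = -1) → ∀ q q' : AliceQuestion (G.S k),
        stateNormSq (P.wordOp k U - s • P.wordOp k V) (P.encState k q) ≤
          stateNormSq (P.wordOp k U - s • P.wordOp k V) (P.encState k q') + ν k := by
  have hinit : ∀ k, nsq (P.init k) = 1 := fun k => (hP.1 k).nsq_eq_one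
  -- The words, the phase and both questions are chosen nonuniformly. Length three is what the magic
  -- square argument requires.
  let ι : ℕ → Type := fun k => {T : P.Test k // T.left.length ≤ 3 ∧ T.right.length ≤ 3} ×
    AliceQuestion (G.S k) × AliceQuestion (G.S k)
  have : ∀ k, Nonempty (ι k) := fun k =>
    ⟨⟨⟨[], [], true, fun _ => true⟩, by simp, by simp⟩, .tele, .tele⟩
  let f : ∀ k, ι k → ℝ := fun k i => |P.test i.1.1 i.2.1 - P.test i.1.1 i.2.2|
  have hf : ∀ k, ∃ i, ∀ j, f k j ≤ 2 * f k i := fun k =>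
    exists_forall_le_two_mul (f k) (fun _ => abs_nonneg _) fun i => by
      have h1 := P.test_nonneg i.1.1 i.2.1
      have h2 := P.test_nonneg i.1.1 i.2.2
      have h3 := P.test_le_one (hinit k) i.1.1 i.2.1
      have h4 := P.test_le_one (hinit k) i.1.1 i.2.2
      exact abs_sub_le_iff.2 ⟨by linarith, by linarith⟩
  choose i hi using hf
  have hneg : Negligible fun k => f k (i k) := by
    have h := hE (P.testAdversary fun k => (i k).1.1)
      (P.testAdversary_efficient hP _ (fun k => (i k).1.2.1) fun k => (i k).1.2.2)
      (fun k => G.encode k (i k).2.1) (fun k => G.encode k (i k).2.2)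
    simpa only [testAdversary_accept] using h
  -- `8 = 4 · 2`: the normalisation of the Hadamard test and the near-maximal choice.
  refine ⟨fun k => 8 * f k (i k), hneg.const_mul 8,
    fun k => mul_nonneg (by norm_num) (abs_nonneg _), fun k U V s hU hV hs q q' => ?_⟩
  obtain ⟨σ, rfl⟩ : ∃ σ : Bool, s = if σ = true then (-1 : ℂ) else 1 := by
    rcases hs with rfl | rfl
    · exact ⟨false, by simp⟩
    · exact ⟨true, by simp⟩
  have h1 := P.stateNormSq_encState_eq_sum_test U V σ q
  have h2 := P.stateNormSq_encState_eq_sum_test U V σ q'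
  have h3 : ∑ z, P.test ⟨U, V, σ, z⟩ q ≤
      ∑ z : Bits (P.aliceLen k), (P.test ⟨U, V, σ, z⟩ q' + 2 * f k (i k)) := by
    refine Finset.sum_le_sum fun z _ => ?_
    have := (le_abs_self _).trans (hi k ⟨⟨⟨U, V, σ, z⟩, hU, hV⟩, q, q'⟩)
    simp only at this
    linarith
  rw [Finset.sum_add_distrib, Finset.sum_const, nsmul_eq_mul] at h3
  have h4 : ((univ : Finset (Bits (P.aliceLen k))).card : ℝ) = 2 ^ P.aliceLen k := by simp
  rw [h4] at h3
  have hpos : (0 : ℝ) < 2 ^ P.aliceLen k := by positivity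
  refine le_of_mul_le_mul_left ?_ hpos
  rw [mul_add, h1, h2]
  linarith

end Prover

/-! ### Vector estimates -/

lemma nsq_add_three_le {N : ℕ} (u v w : Ket N) :
    nsq (u + v + w) ≤ 3 * (nsq u + nsq v + nsq w) := by
  have h := nsq_sum_le univ ![u, v, w]
  simp [Fin.sum_univ_succ, ← add_assoc] at h
  exact h

lemma nsq_add_six_le {N : ℕ} (u v w x y z : Ket N) :
    nsq (u + v + w + x + y + z) ≤ 6 * (nsq u + nsq v + nsq w + nsq x + nsq y + nsq z) := by
  have h := nsq_sum_le univ ![u, v, w, x, y, z]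
  simp [Fin.sum_univ_succ, ← add_assoc] at h
  exact h

lemma nsq_smul_of_norm_eq_one {N : ℕ} {t : ℂ} (ht : ‖t‖ = 1) (v : Ket N) :
    nsq (t • v) = nsq v := by
  rw [nsq_smul, ht, one_pow, one_mul]

lemma norm_eq_one_of_sign {t : ℂ} (ht : t = 1 ∨ t = -1) : ‖t‖ = 1 := by
  rcases ht with rfl | rfl <;> simp

lemma mul_self_of_sign {t : ℂ} (ht : t = 1 ∨ t = -1) : t * t = 1 := by
  rcases ht with rfl | rfl <;> simp

lemma neg_one_pow_sign (m : ℕ) : (-1 : ℂ) ^ m = 1 ∨ (-1 : ℂ) ^ m = -1 := neg_one_pow_eq_or ℂ m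

/-- Operators with a common approximate eigenvector approximately commute on it. -/
lemma nsq_commutator_le {N : ℕ} {A B : QOp N} (hA : ∀ v, nsq (A *ᵥ v) = nsq v)
    (hB : ∀ v, nsq (B *ᵥ v) = nsq v) {s t : ℂ} (hs : ‖s‖ = 1) (ht : ‖t‖ = 1) (v : Ket N) :
    nsq (A *ᵥ (B *ᵥ v) - B *ᵥ (A *ᵥ v)) ≤
      8 * nsq (A *ᵥ v - s • v) + 8 * nsq (B *ᵥ v - t • v) := by
  have e : A *ᵥ (B *ᵥ v) - B *ᵥ (A *ᵥ v) =
      (A *ᵥ (B *ᵥ v - t • v) + t • (A *ᵥ v - s • v)) +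
        -(B *ᵥ (A *ᵥ v - s • v) + s • (B *ᵥ v - t • v)) := by
    simp only [mulVec_sub, mulVec_smul, smul_sub, smul_smul, mul_comm t s]
    abel
  rw [e]
  refine (nsq_add_le _ _).trans ?_
  rw [nsq_neg]
  have h1 := nsq_add_le (A *ᵥ (B *ᵥ v - t • v)) (t • (A *ᵥ v - s • v))
  have h2 := nsq_add_le (B *ᵥ (A *ᵥ v - s • v)) (s • (B *ᵥ v - t • v))
  rw [hA, nsq_smul_of_norm_eq_one ht] at h1
  rw [hB, nsq_smul_of_norm_eq_one hs] at h2
  linarith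

/-- Eigenvalues multiply. -/
lemma nsq_product_relation_le {N : ℕ} {A B C : QOp N} (hA : ∀ v, nsq (A *ᵥ v) = nsq v)
    {r s t : ℂ} (hr : r = 1 ∨ r = -1) (hs : s = 1 ∨ s = -1) (ht : t = 1 ∨ t = -1) (v : Ket N) :
    nsq (A *ᵥ (B *ᵥ v) - (r * s * t) • C *ᵥ v) ≤
      3 * (nsq (B *ᵥ v - s • v) + nsq (A *ᵥ v - r • v) + nsq (C *ᵥ v - t • v)) := by
  have e : A *ᵥ (B *ᵥ v) - (r * s * t) • C *ᵥ v =
      A *ᵥ (B *ᵥ v - s • v) + s • (A *ᵥ v - r • v) + (-(r * s * t)) • (C *ᵥ v - t • v) := by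
    have h : r * s * t * t = s * r := by
      rw [mul_assoc, mul_self_of_sign ht, mul_one, mul_comm]
    simp only [mulVec_sub, mulVec_smul, smul_sub, smul_smul, neg_mul, neg_smul, h]
    abel
  rw [e]
  refine (nsq_add_three_le _ _ _).trans ?_
  have hn : ‖-(r * s * t)‖ = 1 := by
    simp [norm_eq_one_of_sign hr, norm_eq_one_of_sign hs, norm_eq_one_of_sign ht]
  rw [hA, nsq_smul_of_norm_eq_one (norm_eq_one_of_sign hs), nsq_smul_of_norm_eq_one hn]

/-- If `W` acts on `v` almost as a phase, then `M v ≈ 0` persists after `W`. This allows a relation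
to be used to the left of another observable in a word. -/
lemma nsq_mulVec_mulVec_le {N : ℕ} {M W : QOp N} (hM : ∀ v, nsq (M *ᵥ v) ≤ 4 * nsq v)
    {t : ℂ} (ht : ‖t‖ = 1) (v : Ket N) :
    nsq (M *ᵥ (W *ᵥ v)) ≤ 8 * nsq (W *ᵥ v - t • v) + 2 * nsq (M *ᵥ v) := by
  have e : M *ᵥ (W *ᵥ v) = M *ᵥ (W *ᵥ v - t • v) + t • M *ᵥ v := by
    simp only [mulVec_sub, mulVec_smul]
    abel
  rw [e]
  refine (nsq_add_le _ _).trans ?_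
  rw [nsq_smul_of_norm_eq_one ht]
  linarith [hM (W *ᵥ v - t • v)]

/-- When `B v ≈ t v`, braiding with sign `s` amounts to `A v` being nearly an eigenvector of `B`
with eigenvalue `s t`. The question is thereby reduced to one measurement on a fixed vector, where
small bias applies; `nsq_braid_of_eigen` is the way back. -/
lemma nsq_eigen_of_braid {N : ℕ} {A B : QOp N} (hA : ∀ v, nsq (A *ᵥ v) = nsq v)
    {s t : ℂ} (hs : s = 1 ∨ s = -1) (v : Ket N) :
    nsq (B *ᵥ (A *ᵥ v) - (s * t) • A *ᵥ v) ≤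
      2 * nsq (A *ᵥ (B *ᵥ v) - s • B *ᵥ (A *ᵥ v)) + 2 * nsq (B *ᵥ v - t • v) := by
  have e : B *ᵥ (A *ᵥ v) - (s * t) • A *ᵥ v =
      (-s) • (A *ᵥ (B *ᵥ v) - s • B *ᵥ (A *ᵥ v)) + s • A *ᵥ (B *ᵥ v - t • v) := by
    simp only [mulVec_sub, mulVec_smul, smul_sub, smul_smul, neg_mul, neg_smul,
      mul_self_of_sign hs, one_smul]
    abel
  rw [e]
  refine (nsq_add_le _ _).trans ?_
  rw [nsq_smul_of_norm_eq_one (by rw [norm_neg, norm_eq_one_of_sign hs]),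
    nsq_smul_of_norm_eq_one (norm_eq_one_of_sign hs), hA]

lemma nsq_braid_of_eigen {N : ℕ} {A B : QOp N} (hA : ∀ v, nsq (A *ᵥ v) = nsq v)
    {s t : ℂ} (hs : s = 1 ∨ s = -1) (v : Ket N) :
    nsq (A *ᵥ (B *ᵥ v) - s • B *ᵥ (A *ᵥ v)) ≤
      2 * nsq (B *ᵥ (A *ᵥ v) - (s * t) • A *ᵥ v) + 2 * nsq (B *ᵥ v - t • v) := by
  have e : A *ᵥ (B *ᵥ v) - s • B *ᵥ (A *ᵥ v) =
      (-s) • (B *ᵥ (A *ᵥ v) - (s * t) • A *ᵥ v) + A *ᵥ (B *ᵥ v - t • v) := by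
    simp only [mulVec_sub, mulVec_smul, smul_sub, smul_smul, neg_mul, neg_smul,
      ← mul_assoc, mul_self_of_sign hs, one_mul]
    abel
  rw [e]
  refine (nsq_add_le _ _).trans ?_
  rw [nsq_smul_of_norm_eq_one (by rw [norm_neg, norm_eq_one_of_sign hs]), hA]

/-! ### The magic square -/

/-- The cells of a line. -/
def Line.cell (L : Line) (i : Fin 3) : Fin 3 × Fin 3 :=
  match L with
  | .row r => (r, i)
  | .col c => (i, c)

/-- The product of the signs of the cells of a line. -/
def Line.sign (L : Line) : ℂ :=
  match L with
  | .row _ => 1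
  | .col _ => -1

lemma Line.sign_eq (L : Line) : L.sign = 1 ∨ L.sign = -1 := by
  cases L <;> simp [Line.sign]

lemma Line.pos_cell (L : Line) (i : Fin 3) : L.pos (L.cell i) = i := by
  cases L <;> rfl

lemma Line.prod_sign_of_constraint (L : Line) (u : Fin 3 → Bool) (h : L.Constraint u)
    (i j l : Fin 3) (hij : i ≠ j) (hjl : j ≠ l) (hil : i ≠ l) :
    (if u i = true then (-1 : ℂ) else 1) * (if u j = true then -1 else 1) *
      (if u l = true then -1 else 1) = L.sign := by
  have h0 : (if u 0 = true then (-1 : ℂ) else 1) * (if u 1 = true then -1 else 1) *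
      (if u 2 = true then -1 else 1) = L.sign := by
    cases L <;> simp only [Line.Constraint] at h <;> revert h <;>
      generalize u 0 = x <;> generalize u 1 = y <;> generalize u 2 = z <;>
      cases x <;> cases y <;> cases z <;> simp [Line.sign]
  rw [← h0]
  fin_cases i <;> fin_cases j <;> fin_cases l <;> first | exact absurd rfl ‹_› | skip
  · rfl
  all_goals
    simp only [Fin.zero_eta, Fin.mk_one, Fin.reduceFinMk]
    ring

/-- Any answer to a line question can be read as signs that satisfy the constraint. -/
lemma Line.exists_signs (L : Line) : ∃ t : Fin 3 → List Bool → ℂ,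
    (∀ i u, t i u = 1 ∨ t i u = -1) ∧
    (∀ u i j l, i ≠ j → j ≠ l → i ≠ l → t i u * t j u * t l u = L.sign) ∧
    ∀ u : Fin 3 → Bool, L.Constraint u → ∀ i, t i (List.ofFn u) = if u i = true then -1 else 1 := by
  classical
  -- A default assignment for answers that violate the constraint or the format. They lose anyway,
  -- while the product relation is then available for every answer.
  have hd : ∃ d : Fin 3 → Bool, L.Constraint d := by
    cases L with
    | row r => exact ⟨fun _ => false, rfl⟩
    | col c => exact ⟨fun _ => true, rfl⟩
  obtain ⟨d, hd⟩ := hd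
  have hf : ∀ u : List Bool, ∃ f : Fin 3 → Bool, L.Constraint f ∧
      ∀ u' : Fin 3 → Bool, L.Constraint u' → u = List.ofFn u' → f = u' := by
    intro u
    by_cases h : ∃ u' : Fin 3 → Bool, L.Constraint u' ∧ u = List.ofFn u'
    · obtain ⟨u', h1, h2⟩ := h
      exact ⟨u', h1, fun u'' _ h3 => List.ofFn_injective (h2.symm.trans h3)⟩
    · exact ⟨d, hd, fun u' h1 h2 => absurd ⟨u', h1, h2⟩ h⟩
  choose f hf1 hf2 using hf
  refine ⟨fun i u => if f u i = true then -1 else 1, fun i u => ?_, fun u i j l h1 h2 h3 =>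
    L.prod_sign_of_constraint (f u) (hf1 u) i j l h1 h2 h3, fun u hu i => ?_⟩
  · dsimp only
    split_ifs <;> simp
  · simp only [hf2 (List.ofFn u) u hu rfl]

/-! ### Relations between Bob's observables on encrypted states -/

namespace Prover

variable {E : EncryptionScheme} {G : Setup E} (P : Prover G) (k : ℕ)

/-- The squared distance of `U` and `s V` on the state with encrypted question `q`. -/
noncomputable def dist (q : AliceQuestion (G.S k)) (U V : List (G.Letter k)) (s : ℂ) : ℝ :=
  stateNormSq (P.wordOp k U - s • P.wordOp k V) (P.encState k q)

/-- The distances of short words vary by at most `ν` with the encrypted question. -/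
def Switch (ν : ℝ) : Prop :=
  ∀ (U V : List (G.Letter k)) (s : ℂ), U.length ≤ 3 → V.length ≤ 3 → (s = 1 ∨ s = -1) →
    ∀ q q' : AliceQuestion (G.S k), P.dist k q U V s ≤ P.dist k q' U V s + ν

variable {k}

section

variable {q : AliceQuestion (G.S k)}
  {F F' : Bits (E.keyLen k) → Bits (E.ctLen k) → Bits (P.aliceLen k) → ℝ}

lemma avg_add_le {x y : ℝ} (h : P.avg k q F ≤ x) (h' : P.avg k q F' ≤ y) :
    P.avg k q (fun sk c α => F sk c α + F' sk c α) ≤ x + y := by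
  rw [avg_add]
  exact add_le_add h h'

lemma avg_const_mul_le {t x : ℝ} (ht : 0 ≤ t) (h : P.avg k q F ≤ x) :
    P.avg k q (fun sk c α => t * F sk c α) ≤ t * x := by
  rw [avg_const_mul]
  exact mul_le_mul_of_nonneg_left h ht

end

@[simp] lemma wordOp_nil_mulVec (v : Ket (E.ctLen k + P.work k)) :
    P.wordOp k [] *ᵥ v = v := by simp [wordOp]

@[simp] lemma wordOp_cons_mulVec (x : G.Letter k) (l : List (G.Letter k))
    (v : Ket (E.ctLen k + P.work k)) :
    P.wordOp k (x :: l) *ᵥ v = P.letterOp k x *ᵥ (P.wordOp k l *ᵥ v) := by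
  simp [wordOp]

lemma dist_eq (q : AliceQuestion (G.S k)) (U V : List (G.Letter k)) (s : ℂ) :
    P.dist k q U V s = P.avg k q fun _ c α =>
      nsq (P.wordOp k U *ᵥ P.postKet k c α - s • P.wordOp k V *ᵥ P.postKet k c α) := by
  simp only [dist, stateNormSq_encState, sub_mulVec, smul_mulVec]

/-- Multiplying the difference by `-s` exchanges the two words, because `s` is its own inverse. -/
lemma dist_symm (q : AliceQuestion (G.S k)) (U V : List (G.Letter k)) {s : ℂ}
    (hs : s = 1 ∨ s = -1) : P.dist k q U V s = P.dist k q V U s := by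
  have h : ∀ u v : Ket (E.ctLen k + P.work k), nsq (u - s • v) = nsq (v - s • u) := by
    intro u v
    rw [← nsq_smul_of_norm_eq_one (t := -s) (by rw [norm_neg, norm_eq_one_of_sign hs])]
    congr 1
    simp only [smul_sub, smul_smul, neg_mul, neg_smul, mul_self_of_sign hs, one_smul]
    abel
  rw [dist_eq, dist_eq]
  congr 1
  funext sk c α
  exact h _ _

lemma dist_nonneg (q : AliceQuestion (G.S k)) (U V : List (G.Letter k)) (s : ℂ) :
    0 ≤ P.dist k q U V s := by
  rw [dist_eq]
  refine le_trans (le_of_eq ?_) (P.avg_mono (F := fun _ _ _ => 0) fun _ _ _ => nsq_nonneg _)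
  simp [avg]

/-- The letter of the observable `Z(a)`. -/
abbrev letterZ (k : ℕ) (a : Bits (G.n k)) : G.Letter k := ⟨.basis .Z, a⟩

/-- The letter of the observable `X(b)`. -/
abbrev letterX (k : ℕ) (b : Bits (G.n k)) : G.Letter k := ⟨.basis .X, b⟩

lemma neg_one_pow_dot_eq {n : ℕ} {a v : Bits n} {c : Bool} (h : parity a v = c) :
    (-1 : ℂ) ^ dot v a = if c = true then -1 else 1 := by
  rw [neg_one_pow_eq_parity, parity_comm, h]

lemma norm_sign (c : Bool) : ‖(if c = true then (-1 : ℂ) else 1)‖ = 1 := by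
  cases c <;> simp

/-- On the state of this very question both observables act as signs read from one answer, so they
commute there. Default bits for malformed answers cost nothing since these lose. The constant is `8
· 4 · 2`, the last factor undoing the choice of basis. -/
lemma dist_com_le (hP : nsq (P.init k) = 1) (a b : {a : Bits (G.n k) // a ∈ G.S k}) :
    P.dist k (.com a b) [letterZ k a.1, letterX k b.1] [letterX k b.1, letterZ k a.1] 1 ≤
      64 * (1 - P.comWin k a b) := by
  have h1 := P.avg_letterOp_sub_le k (.com a b) hP (letterZ k a.1)
    (fun u v => ∃ ua ub, u = [ua, ub] ∧ parity a.1 v = ua)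
    (fun u => if u.getD 0 false = true then -1 else 1) (fun u => norm_sign _) (by
      rintro _ v ⟨ua, ub, rfl, h⟩
      exact neg_one_pow_dot_eq h)
  have h2 := P.avg_letterOp_sub_le k (.com a b) hP (letterX k b.1)
    (fun u v => ∃ ua ub, u = [ua, ub] ∧ parity b.1 v = ub)
    (fun u => if u.getD 1 false = true then -1 else 1) (fun u => norm_sign _) (by
      rintro _ v ⟨ua, ub, rfl, h⟩
      exact neg_one_pow_dot_eq h)
  have h3 := P.avg_add_le (P.avg_const_mul_le (t := 8) (by norm_num) h1)
    (P.avg_const_mul_le (t := 8) (by norm_num) h2)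
  rw [dist_eq]
  refine ((P.avg_mono fun sk c α => ?_).trans h3).trans (by unfold comWin; linarith)
  simp only [wordOp_cons_mulVec, wordOp_nil_mulVec, one_smul]
  exact nsq_commutator_le (P.nsq_letterOp k _) (P.nsq_letterOp k _)
    (norm_sign ((E.dec k sk (List.ofFn α)).getD 0 false))
    (norm_sign ((E.dec k sk (List.ofFn α)).getD 1 false)) _

/-- The letter of a cell of the magic square. -/
def cellLetter (a b : {a : Bits (G.n k) // a ∈ G.S k}) (j : Fin 3 × Fin 3) : G.Letter k :=
  if j = (0, 1) then letterZ k a.1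
  else if j = (1, 0) then letterX k b.1
  else ⟨.cell a b j, fun _ => true⟩

lemma msRound_le_one (hP : nsq (P.init k) = 1) (a b : {a : Bits (G.n k) // a ∈ G.S k})
    (L : Line) (j : Fin 3 × Fin 3) : P.msRound k a b L j ≤ 1 := by
  unfold msRound
  split_ifs <;> exact P.roundWin_le_one k _ hP _ _

/-- There are nine cells with two lines each, all equally likely, and no other round can have
negative loss. -/
lemma one_sub_msRound_le (hP : nsq (P.init k) = 1) (a b : {a : Bits (G.n k) // a ∈ G.S k})
    (L : Line) (i : Fin 3) :
    1 - P.msRound k a b L (L.cell i) ≤ 18 * (1 - P.msWin k a b) := by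
  have h := fun L j => P.msRound_le_one hP a b L j
  have h1 : ∑ j : Fin 3 × Fin 3, ((1 - P.msRound k a b (.row j.1) j) +
      (1 - P.msRound k a b (.col j.2) j)) = 18 * (1 - P.msWin k a b) := by
    rw [msWin, ← Finset.mul_sum, Finset.sum_add_distrib, Finset.sum_add_distrib,
      Finset.sum_sub_distrib, Finset.sum_sub_distrib]
    simp
    ring
  rw [← h1]
  refine le_trans ?_ (Finset.single_le_sum (f := fun j : Fin 3 × Fin 3 =>
    (1 - P.msRound k a b (.row j.1) j) + (1 - P.msRound k a b (.col j.2) j))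
    (fun j _ => by linarith [h (.row j.1) j, h (.col j.2) j]) (mem_univ (L.cell i)))
  cases L with
  | row r => simpa [Line.cell] using h _ _
  | col c => simpa [Line.cell] using h _ _

lemma avg_cellLetter_le (hP : nsq (P.init k) = 1) (a b : {a : Bits (G.n k) // a ∈ G.S k})
    (L : Line) (i : Fin 3) (t : Fin 3 → List Bool → ℂ) (ht : ∀ i u, t i u = 1 ∨ t i u = -1)
    (ht' : ∀ u : Fin 3 → Bool, L.Constraint u → ∀ i,
      t i (List.ofFn u) = if u i = true then -1 else 1) :
    P.avg k (.ms a b L) (fun sk c α =>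
      nsq (P.letterOp k (cellLetter a b (L.cell i)) *ᵥ P.postKet k c α -
        t i (E.dec k sk (List.ofFn α)) • P.postKet k c α)) ≤ 72 * (1 - P.msWin k a b) := by
  suffices h : P.avg k (.ms a b L) (fun sk c α =>
      nsq (P.letterOp k (cellLetter a b (L.cell i)) *ᵥ P.postKet k c α -
        t i (E.dec k sk (List.ofFn α)) • P.postKet k c α)) ≤
        4 * (1 - P.msRound k a b L (L.cell i)) by
    linarith [P.one_sub_msRound_le hP a b L i]
  have hn : ∀ u, ‖t i u‖ = 1 := fun u => norm_eq_one_of_sign (ht i u)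
  unfold msRound cellLetter
  split_ifs with h1 h2
  · refine P.avg_letterOp_sub_le k _ hP (letterZ k a.1) _ (t i) hn ?_
    rintro _ v ⟨u, rfl, hu, h⟩
    rw [L.pos_cell] at h
    rw [ht' u hu]
    exact neg_one_pow_dot_eq h
  · refine P.avg_letterOp_sub_le k _ hP (letterX k b.1) _ (t i) hn ?_
    rintro _ v ⟨u, rfl, hu, h⟩
    rw [L.pos_cell] at h
    rw [ht' u hu]
    exact neg_one_pow_dot_eq h
  · refine P.avg_letterOp_sub_le k _ hP ⟨.cell a b (L.cell i), fun _ => true⟩ _ (t i) hn ?_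
    rintro _ v ⟨u, rfl, hu, h⟩
    rw [ht' u hu, neg_one_pow_dot]
    change ∏ j : Fin 1, _ = _
    simp only [Finset.univ_unique, Finset.prod_singleton, Bool.and_true]
    rw [L.pos_cell] at h
    rw [← h]
    rfl

variable {ν : ℝ}

/-- The relation of a line holds on every state. -/
lemma dist_line_le (hP : nsq (P.init k) = 1) (hν : P.Switch k ν)
    (a b : {a : Bits (G.n k) // a ∈ G.S k}) (L : Line) {i j l : Fin 3} (hij : i ≠ j)
    (hjl : j ≠ l) (hil : i ≠ l) (q : AliceQuestion (G.S k)) :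
    P.dist k q [cellLetter a b (L.cell i), cellLetter a b (L.cell j)]
      [cellLetter a b (L.cell l)] L.sign ≤ 648 * (1 - P.msWin k a b) + ν := by
  obtain ⟨t, h1, h2, h3⟩ := L.exists_signs
  -- The relation is proved on the state of `L` itself, where all three cells act as decrypted
  -- signs; `648 = 3 · 3 · 72`.
  refine (hν _ _ _ (by simp) (by simp) L.sign_eq q (.ms a b L)).trans ?_
  have e := fun i => P.avg_cellLetter_le hP a b L i t h1 h3
  have h := P.avg_const_mul_le (t := 3) (by norm_num)
    (P.avg_add_le (P.avg_add_le (e j) (e i)) (e l))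
  rw [dist_eq]
  refine add_le_add_left (((P.avg_mono fun sk c α => ?_).trans h).trans (by linarith)) ν
  simp only [wordOp_cons_mulVec, wordOp_nil_mulVec]
  rw [← h2 (E.dec k sk (List.ofFn α)) i j l hij hjl hil]
  exact nsq_product_relation_le (P.nsq_letterOp k _) (h1 i _) (h1 j _) (h1 l _) _

/-- The relation of a line holds on every state after a cell observable has been applied. -/
lemma dist_line_cell_le (hP : nsq (P.init k) = 1) (hν : P.Switch k ν)
    (a b : {a : Bits (G.n k) // a ∈ G.S k}) (L : Line) {i j l : Fin 3} (hij : i ≠ j)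
    (hjl : j ≠ l) (hil : i ≠ l) (L' : Line) (m : Fin 3) (q : AliceQuestion (G.S k)) :
    P.dist k q
      [cellLetter a b (L.cell i), cellLetter a b (L.cell j), cellLetter a b (L'.cell m)]
      [cellLetter a b (L.cell l), cellLetter a b (L'.cell m)] L.sign ≤
        1872 * (1 - P.msWin k a b) + 3 * ν := by
  obtain ⟨t, h1, h2, h3⟩ := L'.exists_signs
  -- On the state of `L'` the rightmost observable is nearly a sign, and the relation of `L` has
  -- already been switched there; `1872 = 8 · 72 + 2 · 648`.
  refine (hν _ _ _ (by simp) (by simp) L.sign_eq q (.ms a b L')).trans ?_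
  have e1 := P.avg_cellLetter_le hP a b L' m t h1 h3
  have e2 := P.dist_line_le hP hν a b L hij hjl hil (.ms a b L')
  rw [dist_eq] at e2 ⊢
  have h := P.avg_add_le (P.avg_const_mul_le (t := 8) (by norm_num) e1)
    (P.avg_const_mul_le (t := 2) (by norm_num) e2)
  refine le_trans (add_le_add_left ((P.avg_mono fun sk c α => ?_).trans h) ν) (by linarith)
  have h4 := nsq_mulVec_mulVec_le
    (M := P.wordOp k [cellLetter a b (L.cell i), cellLetter a b (L.cell j)] -
      L.sign • P.wordOp k [cellLetter a b (L.cell l)])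
    (W := P.letterOp k (cellLetter a b (L'.cell m))) (by
      intro v
      rw [sub_eq_add_neg, add_mulVec, neg_mulVec, smul_mulVec]
      refine (nsq_add_le _ _).trans ?_
      rw [nsq_neg, nsq_smul_of_norm_eq_one (norm_eq_one_of_sign L.sign_eq), nsq_wordOp,
        nsq_wordOp]
      linarith) (norm_eq_one_of_sign (h1 m (E.dec k sk (List.ofFn α)))) (P.postKet k c α)
  simp only [sub_mulVec, smul_mulVec] at h4
  simp only [wordOp_cons_mulVec, wordOp_nil_mulVec] at h4 ⊢
  exact h4

/-- The magic square relations imply anticommutation of the two basis observables. -/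
lemma dist_ms_le (hP : nsq (P.init k) = 1) (hν : P.Switch k ν)
    (a b : {a : Bits (G.n k) // a ∈ G.S k}) (q : AliceQuestion (G.S k)) :
    P.dist k q [letterZ k a.1, letterX k b.1] [letterX k b.1, letterZ k a.1] (-1) ≤
      45360 * (1 - P.msWin k a b) + 72 * ν := by
  -- With `A_rc` the observable of a cell, the chain on `ψ` is `A01 A10 ≈ -A01 A00 A20 ≈ -A02 A20 ≈
  -- -A02 A22 A21 ≈ A12 A21 ≈ -A12 A11 A01 ≈ -A10 A01`. Three columns contribute the sign; `45360 =
  -- 6 · 3 · (648 + 1872)`.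
  have r1 := P.dist_line_le hP hν a b (.col 0) (i := 0) (j := 2) (l := 1)
    (by decide) (by decide) (by decide) q
  have r2 := P.dist_line_le hP hν a b (.row 2) (i := 2) (j := 1) (l := 0)
    (by decide) (by decide) (by decide) q
  have r3 := P.dist_line_le hP hν a b (.col 1) (i := 1) (j := 0) (l := 2)
    (by decide) (by decide) (by decide) q
  have k1 := P.dist_line_cell_le hP hν a b (.row 0) (i := 1) (j := 0) (l := 2)
    (by decide) (by decide) (by decide) (.col 0) 2 q
  have k2 := P.dist_line_cell_le hP hν a b (.col 2) (i := 0) (j := 2) (l := 1)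
    (by decide) (by decide) (by decide) (.row 2) 1 q
  have k3 := P.dist_line_cell_le hP hν a b (.row 1) (i := 2) (j := 1) (l := 0)
    (by decide) (by decide) (by decide) (.row 0) 1 q
  have hZ : letterZ k a.1 = cellLetter a b (0, 1) := by simp [cellLetter]
  have hX : letterX k b.1 = cellLetter a b (1, 0) := by simp [cellLetter]
  simp only [Line.cell, Line.sign] at r1 r2 r3 k1 k2 k3
  rw [dist_eq] at r1 r2 r3 k1 k2 k3
  have h := P.avg_const_mul_le (t := 6) (by norm_num) (P.avg_add_le (P.avg_add_le (P.avg_add_le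
    (P.avg_add_le (P.avg_add_le r1 k1) r2) k2) r3) k3)
  rw [hZ, hX, dist_eq]
  refine ((P.avg_mono fun sk c α => ?_).trans h).trans (by linarith)
  simp only [wordOp_cons_mulVec, wordOp_nil_mulVec]
  have e := nsq_add_six_le
    (P.letterOp k (cellLetter a b (0, 1)) *ᵥ
      (P.letterOp k (cellLetter a b (0, 0)) *ᵥ
        (P.letterOp k (cellLetter a b (2, 0)) *ᵥ P.postKet k c α) -
        (-1 : ℂ) • P.letterOp k (cellLetter a b (1, 0)) *ᵥ P.postKet k c α))
    (-(P.letterOp k (cellLetter a b (0, 1)) *ᵥ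
      (P.letterOp k (cellLetter a b (0, 0)) *ᵥ
        (P.letterOp k (cellLetter a b (2, 0)) *ᵥ P.postKet k c α)) -
        (1 : ℂ) • P.letterOp k (cellLetter a b (0, 2)) *ᵥ
          (P.letterOp k (cellLetter a b (2, 0)) *ᵥ P.postKet k c α)))
    (P.letterOp k (cellLetter a b (0, 2)) *ᵥ
      (P.letterOp k (cellLetter a b (2, 2)) *ᵥ
        (P.letterOp k (cellLetter a b (2, 1)) *ᵥ P.postKet k c α) -
        (1 : ℂ) • P.letterOp k (cellLetter a b (2, 0)) *ᵥ P.postKet k c α))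
    (-(P.letterOp k (cellLetter a b (0, 2)) *ᵥ
      (P.letterOp k (cellLetter a b (2, 2)) *ᵥ
        (P.letterOp k (cellLetter a b (2, 1)) *ᵥ P.postKet k c α)) -
        (-1 : ℂ) • P.letterOp k (cellLetter a b (1, 2)) *ᵥ
          (P.letterOp k (cellLetter a b (2, 1)) *ᵥ P.postKet k c α)))
    (P.letterOp k (cellLetter a b (1, 2)) *ᵥ
      (P.letterOp k (cellLetter a b (1, 1)) *ᵥ
        (P.letterOp k (cellLetter a b (0, 1)) *ᵥ P.postKet k c α) -
        (-1 : ℂ) • P.letterOp k (cellLetter a b (2, 1)) *ᵥ P.postKet k c α))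
    (-(P.letterOp k (cellLetter a b (1, 2)) *ᵥ
      (P.letterOp k (cellLetter a b (1, 1)) *ᵥ
        (P.letterOp k (cellLetter a b (0, 1)) *ᵥ P.postKet k c α)) -
        (1 : ℂ) • P.letterOp k (cellLetter a b (1, 0)) *ᵥ
          (P.letterOp k (cellLetter a b (0, 1)) *ᵥ P.postKet k c α)))
  simp only [nsq_neg, nsq_letterOp] at e
  refine le_trans (le_of_eq ?_) e
  congr 1
  simp only [mulVec_sub, neg_smul, one_smul, mulVec_neg]
  abel

/-- The average defect over the strings in `S`. -/
lemma sum_dist_le (hP : nsq (P.init k) = 1) (hν : P.Switch k ν) (hν0 : 0 ≤ ν) {ε : ℝ}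
    (hS : (G.S k).Nonempty) (hw : 1 - ε ≤ P.braidingWin k) (q : AliceQuestion (G.S k)) :
    (1 / ((G.S k).card : ℝ)) * ∑ a ∈ G.S k, (1 / ((G.S k).card : ℝ)) * ∑ b ∈ G.S k,
      P.dist k q [letterZ k a, letterX k b] [letterX k b, letterZ k a] ((-1) ^ dot a b) ≤
        45360 * ε + 72 * ν := by
  have hc : (0 : ℝ) < (G.S k).card := by exact_mod_cast hS.card_pos
  have key : ∀ a b : {a : Bits (G.n k) // a ∈ G.S k},
      P.dist k q [letterZ k a.1, letterX k b.1] [letterX k b.1, letterZ k a.1]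
        ((-1) ^ dot a.1 b.1) ≤
      45360 * (1 - if parity a.1 b.1 = true then P.msWin k a b else P.comWin k a b) +
        72 * ν := by
    intro a b
    rw [neg_one_pow_eq_parity]
    split_ifs with h
    · exact P.dist_ms_le hP hν a b q
    · have h1 := hν [letterZ k a.1, letterX k b.1] [letterX k b.1, letterZ k a.1] 1 (by simp)
        (by simp) (Or.inl rfl) q (.com a b)
      have h2 := P.dist_com_le hP a b
      have h3 := P.dist_nonneg (.com a b) [letterZ k a.1, letterX k b.1]
        [letterX k b.1, letterZ k a.1] 1
      linarith
  simp only [← Finset.mul_sum]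
  rw [← mul_assoc]
  have e1 : ∀ f : Bits (G.n k) → ℝ, ∑ a ∈ G.S k, f a =
      ∑ a : {a : Bits (G.n k) // a ∈ G.S k}, f a.1 := fun f => (Finset.sum_coe_sort _ f).symm
  simp only [e1]
  have h : ∑ a : {a : Bits (G.n k) // a ∈ G.S k}, ∑ b : {a : Bits (G.n k) // a ∈ G.S k},
      P.dist k q [letterZ k a.1, letterX k b.1] [letterX k b.1, letterZ k a.1]
        ((-1) ^ dot a.1 b.1) ≤
      (45360 + 72 * ν) * (G.S k).card ^ 2 - 45360 *
        ∑ a : {a : Bits (G.n k) // a ∈ G.S k}, ∑ b : {a : Bits (G.n k) // a ∈ G.S k},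
          if parity a.1 b.1 = true then P.msWin k a b else P.comWin k a b := by
    refine (Finset.sum_le_sum fun a _ => Finset.sum_le_sum fun b _ => key a b).trans
      (le_of_eq ?_)
    simp only [mul_sub, Finset.sum_add_distrib, Finset.sum_sub_distrib, ← Finset.mul_sum,
      Finset.sum_const, Finset.card_univ, Fintype.card_coe, nsmul_eq_mul]
    ring
  have hpos : (0 : ℝ) ≤ 1 / ((G.S k).card : ℝ) * (1 / ((G.S k).card : ℝ)) := by positivity
  refine (mul_le_mul_of_nonneg_left h hpos).trans ?_
  rw [braidingWin] at hw
  have e2 : 1 / ((G.S k).card : ℝ) * (1 / ((G.S k).card : ℝ)) = 1 / ((G.S k).card : ℝ) ^ 2 := by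
    field_simp
  have e3 : 1 / ((G.S k).card : ℝ) ^ 2 * ((G.S k).card : ℝ) ^ 2 = 1 := by
    field_simp
  rw [e2]
  linear_combination 45360 * hw + (45360 + 72 * ν) * e3

end Prover

namespace Prover

variable {E : EncryptionScheme} {G : Setup E} (P : Prover G) {k : ℕ}

/-- The letter of the observable `W(b)`. -/
abbrev letterOf (k : ℕ) (W : Basis) (b : Bits (G.n k)) : G.Letter k := ⟨.basis W, b⟩

/-! ### From the small-bias set to all strings -/

lemma norm_sq_sign_sub {n : ℕ} (s w b : Bits n) :
    ‖(-1 : ℂ) ^ dot s b - (-1) ^ dot w b‖ ^ 2 = 2 * (1 - (-1 : ℝ) ^ dot b (bxor s w)) := by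
  rw [dot_comm b, neg_one_pow_dot_bxor]
  rcases neg_one_pow_eq_or ℝ (dot s b) with h1 | h1 <;>
    rcases neg_one_pow_eq_or ℝ (dot w b) with h2 | h2 <;>
    · have h1' := congrArg (fun x : ℝ => (x : ℂ)) h1
      have h2' := congrArg (fun x : ℝ => (x : ℂ)) h2
      push_cast at h1' h2'
      rw [h1, h2, h1', h2']
      norm_num

/-- On average over all strings, the distance from a character is controlled by its average over
a small-bias set. -/
lemma bias_extension {μ : ℝ} (hμ : μ < 1) (hS : IsBiased μ (G.S k)) (W : Basis)
    (w : Bits (G.n k)) (φ : Ket (E.ctLen k + P.work k)) :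
    1 / (2 : ℝ) ^ G.n k * ∑ b, nsq (P.letterOp k (letterOf k W b) *ᵥ φ - (-1 : ℂ) ^ dot w b • φ) ≤
      1 / (1 - μ) * (1 / ((G.S k).card : ℝ) * ∑ b ∈ G.S k,
        nsq (P.letterOp k (letterOf k W b) *ᵥ φ - (-1 : ℂ) ^ dot w b • φ)) := by
  have hμ' : 0 < 1 - μ := by linarith
  have hc : (0 : ℝ) < (G.S k).card := by exact_mod_cast hS.1.card_pos
  have h : ∀ b, nsq (P.letterOp k (letterOf k W b) *ᵥ φ - (-1 : ℂ) ^ dot w b • φ) =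
      ∑ s : Bits (G.n k), 2 * (1 - (-1 : ℝ) ^ dot b (bxor s w)) * P.mass k (.basis W) s φ := by
    intro b
    rw [nsq_letterOp_sub_smul]
    exact Finset.sum_congr rfl fun s _ => congrArg (· * _) (norm_sq_sign_sub s w b)
  simp only [h]
  rw [Finset.sum_comm, Finset.sum_comm (s := G.S k)]
  simp only [Finset.mul_sum (univ : Finset (Bits (G.n k))), ← Finset.sum_mul]
  refine Finset.sum_le_sum fun s _ => ?_
  rw [← mul_assoc, ← mul_assoc, ← mul_assoc]
  refine mul_le_mul_of_nonneg_right ?_ (P.mass_nonneg _ _ _ _)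
  simp only [← Finset.mul_sum, Finset.sum_sub_distrib, Finset.sum_const, nsmul_eq_mul, mul_one]
  have h1 : ∑ b : Bits (G.n k), (-1 : ℝ) ^ dot b (bxor s w) =
      if bxor s w = (fun _ => false) then 2 ^ G.n k else 0 := by
    simp only [dot_comm _ (bxor s w)]
    exact sum_neg_one_pow_dot _
  have h2 : ((univ : Finset (Bits (G.n k))).card : ℝ) = 2 ^ G.n k := by simp
  have h3 : (0 : ℝ) < 2 ^ G.n k := by positivity
  rw [h1, h2]
  -- The outcome `s = w` contributes 0 to both averages; any other has weight 2 on the left and at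
  -- least `2(1 - μ)` in the average over `S`.
  split_ifs with h0
  · rw [sub_self, mul_zero, mul_zero, h0]
    simp [dot]
  · have h4 := (abs_le.1 (hS.2 _ h0)).2
    rw [div_le_iff₀ hc] at h4
    rw [sub_zero, mul_left_comm, one_div_mul_cancel h3.ne', mul_one]
    calc (2 : ℝ) = 1 / (1 - μ) * (1 / ((G.S k).card : ℝ)) * (2 * ((1 - μ) * (G.S k).card)) := by
          field_simp
      _ ≤ _ := by
          gcongr
          linarith

/-- Alice's answer to an encrypted basis question determines the observables of this basis. -/
lemma exists_basis_signs (hP : nsq (P.init k) = 1) {ε : ℝ} (hw : 1 - ε ≤ P.consistencyWin k)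
    (W : Basis) : ∃ g : List Bool → Bits (G.n k), ∀ b,
      P.avg k (.basis W) (fun sk c α => nsq (P.letterOp k (letterOf k W b) *ᵥ P.postKet k c α -
        (-1 : ℂ) ^ dot (g (E.dec k sk (List.ofFn α))) b • P.postKet k c α)) ≤ 8 * ε := by
  have hg : ∀ v : Bits (G.n k), (fun i : Fin (G.n k) => (List.ofFn v).getD i false) = v := by
    intro v
    funext i
    simp
  refine ⟨fun l i => l.getD i false, fun b => ?_⟩
  have h := P.avg_letterOp_sub_le k (.basis W) hP (letterOf k W b)
    (fun u v => u = List.ofFn (show Bits (G.n k) from v))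
    (fun u => (-1 : ℂ) ^ dot (fun i => u.getD i false) b) (fun u => norm_neg_one_pow _) (by
      rintro _ v rfl
      exact congrArg (fun z => (-1 : ℂ) ^ dot z b) (hg v).symm)
  refine h.trans ?_
  -- Since the other basis wins with probability at most 1, each basis loses with probability at
  -- most `2ε`; hence `8 = 4 · 2`.
  have hX := P.roundWin_le_one k (.basis .X) hP (.basis .X)
    fun u v => u = List.ofFn (show Bits (G.n k) from v)
  have hZ := P.roundWin_le_one k (.basis .Z) hP (.basis .Z)
    fun u v => u = List.ofFn (show Bits (G.n k) from v)
  unfold consistencyWin at hw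
  cases W with
  | X => linarith
  | Z => linarith

/-- If the braiding relation of an observable with the observables `W(b)` holds on average over
a small-bias set, then it holds on average over all strings. -/
lemma sum_dist_extension (hP : nsq (P.init k) = 1) {μ : ℝ} (hμ : μ < 1)
    (hS : IsBiased μ (G.S k)) {ε : ℝ} (hw : 1 - ε ≤ P.consistencyWin k) (W : Basis)
    (x : G.Letter k) (a : Bits (G.n k)) :
    1 / (2 : ℝ) ^ G.n k * ∑ b, P.dist k (.basis W) [x, letterOf k W b] [letterOf k W b, x]
        ((-1) ^ dot a b) ≤
      4 / (1 - μ) * (1 / ((G.S k).card : ℝ) * ∑ b ∈ G.S k,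
        P.dist k (.basis W) [x, letterOf k W b] [letterOf k W b, x] ((-1) ^ dot a b)) +
      (32 / (1 - μ) + 16) * ε := by
  have hμ' : 0 < 1 - μ := by linarith
  have hc : (0 : ℝ) < (G.S k).card := by exact_mod_cast hS.1.card_pos
  have h2 : (0 : ℝ) < 2 ^ G.n k := by positivity
  obtain ⟨g, hg⟩ := P.exists_basis_signs hP hw W
  -- The failure of `xψ` to be an eigenvector of `W(b)` with the character of `a` shifted by Alice's
  -- answer. It is comparable with the braiding defect in both directions, with factor 2 and error
  -- `16ε = 2 · 8ε`.
  let f : Bits (G.n k) → ℝ := fun b => P.avg k (.basis W) fun sk c α =>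
    nsq (P.letterOp k (letterOf k W b) *ᵥ (P.letterOp k x *ᵥ P.postKet k c α) -
      (-1 : ℂ) ^ dot (bxor a (g (E.dec k sk (List.ofFn α)))) b •
        P.letterOp k x *ᵥ P.postKet k c α)
  have hf1 : ∀ b, P.dist k (.basis W) [x, letterOf k W b] [letterOf k W b, x] ((-1) ^ dot a b) ≤
      2 * f b + 16 * ε := by
    intro b
    have h := P.avg_add_le (P.avg_const_mul_le (t := 2) (by norm_num) (le_refl (f b)))
      (P.avg_const_mul_le (t := 2) (by norm_num) (hg b))
    rw [dist_eq]
    refine ((P.avg_mono fun sk c α => ?_).trans h).trans (by linarith)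
    simp only [wordOp_cons_mulVec, wordOp_nil_mulVec]
    rw [neg_one_pow_dot_bxor]
    exact nsq_braid_of_eigen (P.nsq_letterOp k _) (neg_one_pow_sign _) _
  have hf2 : ∀ b, f b ≤
      2 * P.dist k (.basis W) [x, letterOf k W b] [letterOf k W b, x] ((-1) ^ dot a b) +
        16 * ε := by
    intro b
    have h := P.avg_add_le (P.avg_const_mul_le (t := 2) (by norm_num) (le_of_eq
      (P.dist_eq (.basis W) [x, letterOf k W b] [letterOf k W b, x] ((-1) ^ dot a b)).symm))
      (P.avg_const_mul_le (t := 2) (by norm_num) (hg b))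
    refine ((P.avg_mono fun sk c α => ?_).trans h).trans (by linarith)
    simp only [wordOp_cons_mulVec, wordOp_nil_mulVec]
    rw [neg_one_pow_dot_bxor]
    exact nsq_eigen_of_braid (P.nsq_letterOp k _) (neg_one_pow_sign _) _
  have hf3 : 1 / (2 : ℝ) ^ G.n k * ∑ b, f b ≤
      1 / (1 - μ) * (1 / ((G.S k).card : ℝ) * ∑ b ∈ G.S k, f b) := by
    simp only [f, ← P.avg_sum, ← P.avg_const_mul]
    exact P.avg_mono fun sk c α => P.bias_extension hμ hS W _ _
  have hcard : ((univ : Finset (Bits (G.n k))).card : ℝ) = 2 ^ G.n k := by simp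
  calc 1 / (2 : ℝ) ^ G.n k * ∑ b, P.dist k (.basis W) [x, letterOf k W b] [letterOf k W b, x]
        ((-1) ^ dot a b)
      ≤ 1 / (2 : ℝ) ^ G.n k * ∑ b, (2 * f b + 16 * ε) := by
        gcongr with b
        exact hf1 b
    _ = 2 * (1 / (2 : ℝ) ^ G.n k * ∑ b, f b) + 16 * ε := by
        rw [Finset.sum_add_distrib, ← Finset.mul_sum, Finset.sum_const, nsmul_eq_mul, hcard]
        field_simp
    _ ≤ 2 * (1 / (1 - μ) * (1 / ((G.S k).card : ℝ) * ∑ b ∈ G.S k,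
          (2 * P.dist k (.basis W) [x, letterOf k W b] [letterOf k W b, x] ((-1) ^ dot a b) +
            16 * ε))) + 16 * ε := by
        refine add_le_add_left (mul_le_mul_of_nonneg_left (hf3.trans ?_) (by norm_num)) _
        gcongr with b
        exact hf2 b
    _ = _ := by
        rw [Finset.sum_add_distrib, ← Finset.mul_sum, Finset.sum_const, nsmul_eq_mul]
        field_simp
        ring

/-! ### Extending both strings and assembling the bound -/

lemma braidingDefect_eq (q : AliceQuestion (G.S k)) :
    P.braidingDefect k q = 1 / (2 : ℝ) ^ G.n k * ∑ a, 1 / (2 : ℝ) ^ G.n k * ∑ b,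
      P.dist k q [letterZ k a, letterX k b] [letterX k b, letterZ k a] ((-1) ^ dot a b) := by
  have e : ∀ a b, P.dist k q [letterZ k a, letterX k b] [letterX k b, letterZ k a]
      ((-1) ^ dot a b) = stateNormSq (P.obs k .Z a * P.obs k .X b -
        (-1 : ℂ) ^ dot a b • (P.obs k .X b * P.obs k .Z a)) (P.encState k q) := by
    intro a b
    simp only [dist, wordOp, obs_eq_letterOp, List.map_cons, List.map_nil, List.prod_cons,
      List.prod_nil, mul_one]
  simp only [e]
  rw [braidingDefect, ← Finset.mul_sum, ← mul_assoc, ← sq, _root_.one_div_pow]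

lemma average_add_const_le {ι : Type*} {s : Finset ι} (hs : s.Nonempty) {f g : ι → ℝ} {c : ℝ}
    (h : ∀ i ∈ s, f i ≤ g i + c) :
    1 / (s.card : ℝ) * ∑ i ∈ s, f i ≤ 1 / (s.card : ℝ) * ∑ i ∈ s, g i + c := by
  have hc : (0 : ℝ) < s.card := by exact_mod_cast hs.card_pos
  calc _ ≤ 1 / (s.card : ℝ) * ∑ i ∈ s, (g i + c) := by
        gcongr with i hi
        exact h i hi
    _ = _ := by
        rw [Finset.sum_add_distrib, Finset.sum_const, nsmul_eq_mul]
        field_simp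

/-- The braiding relation for all strings, on the state of any question. -/
theorem braidingDefect_le (hP : nsq (P.init k) = 1) {μ : ℝ} (hμ : μ < 1)
    (hS : IsBiased μ (G.S k)) {ε ν : ℝ} (hν : P.Switch k ν) (hν0 : 0 ≤ ν)
    (hw : 1 - ε ≤ P.braidingWin k) (hw' : 1 - ε ≤ P.consistencyWin k)
    (q : AliceQuestion (G.S k)) :
    P.braidingDefect k q ≤
      (4 / (1 - μ) * (4 / (1 - μ) * 45360 + (32 / (1 - μ) + 16)) + (32 / (1 - μ) + 16)) * ε +
        (4 / (1 - μ) * (4 / (1 - μ) * 72 + 1) + 1) * ν := by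
  have hμ' : 0 < 1 - μ := by linarith
  have hκ : 0 ≤ 4 / (1 - μ) := by positivity
  have hcard : (2 : ℝ) ^ G.n k = ((univ : Finset (Bits (G.n k))).card : ℝ) := by simp
  have hne : (univ : Finset (Bits (G.n k))).Nonempty := univ_nonempty
  let D : AliceQuestion (G.S k) → Bits (G.n k) → Bits (G.n k) → ℝ := fun q a b =>
    P.dist k q [letterZ k a, letterX k b] [letterX k b, letterZ k a] ((-1) ^ dot a b)
  have hD : ∀ q q' a b, D q a b ≤ D q' a b + ν := fun q q' a b =>
    hν _ _ _ (by simp) (by simp) (neg_one_pow_sign _) q q'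
  have h0 : 1 / ((G.S k).card : ℝ) * ∑ a ∈ G.S k, 1 / ((G.S k).card : ℝ) * ∑ b ∈ G.S k,
      D (.basis .X) a b ≤ 45360 * ε + 72 * ν := P.sum_dist_le hP hν hν0 hS.1 hw _
  -- Extension in `b`, with `a` still in `S`, on the state whose answers determine the signs of
  -- `X(b)`.
  have h1 : 1 / ((G.S k).card : ℝ) * ∑ a ∈ G.S k, 1 / (2 : ℝ) ^ G.n k * ∑ b,
      D (.basis .X) a b ≤ 4 / (1 - μ) * (45360 * ε + 72 * ν) + (32 / (1 - μ) + 16) * ε := by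
    refine (average_add_const_le hS.1 fun a _ =>
      P.sum_dist_extension hP hμ hS hw' .X (letterZ k a) a).trans ?_
    rw [← Finset.mul_sum, mul_left_comm]
    exact add_le_add_left (mul_le_mul_of_nonneg_left h0 hκ) _
  -- Extension in `a` needs the signs of `Z(a)`, hence the switch to the state of the question `Z`.
  have h2 : 1 / (2 : ℝ) ^ G.n k * ∑ b, 1 / ((G.S k).card : ℝ) * ∑ a ∈ G.S k,
      D (.basis .Z) a b ≤ 4 / (1 - μ) * (45360 * ε + 72 * ν) + (32 / (1 - μ) + 16) * ε + ν := by
    have h := fun b => average_add_const_le hS.1 fun a _ => hD (.basis .Z) (.basis .X) a b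
    refine le_trans ?_ (add_le_add_left h1 ν)
    rw [hcard]
    refine (average_add_const_le hne fun b _ => h b).trans (le_of_eq ?_)
    congr 1
    simp only [← Finset.mul_sum]
    rw [Finset.sum_comm]
    ring
  have h3 : 1 / (2 : ℝ) ^ G.n k * ∑ b, 1 / (2 : ℝ) ^ G.n k * ∑ a, D (.basis .Z) a b ≤
      4 / (1 - μ) * (4 / (1 - μ) * (45360 * ε + 72 * ν) + (32 / (1 - μ) + 16) * ε + ν) +
        (32 / (1 - μ) + 16) * ε := by
    -- `sum_dist_extension` wants the observable being extended on the right in the first word, so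
    -- the words are exchanged.
    have hsymm : ∀ a b, D (.basis .Z) a b = P.dist k (.basis .Z) [letterX k b, letterZ k a]
        [letterZ k a, letterX k b] ((-1) ^ dot b a) := fun a b => by
      rw [dot_comm b a]
      exact P.dist_symm _ _ _ (neg_one_pow_sign _)
    simp only [hsymm] at h2 ⊢
    refine le_trans ?_ (add_le_add_left (mul_le_mul_of_nonneg_left h2 hκ) _)
    rw [hcard]
    refine (average_add_const_le hne (g := fun b => 4 / (1 - μ) * (1 / ((G.S k).card : ℝ) *
      ∑ a ∈ G.S k, P.dist k (.basis .Z) [letterX k b, letterZ k a] [letterZ k a, letterX k b]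
        ((-1) ^ dot b a))) fun b _ => ?_).trans (le_of_eq (congrArg (· + _) ?_))
    · rw [← hcard]
      exact P.sum_dist_extension hP hμ hS hw' .Z (letterX k b) b
    · rw [← Finset.mul_sum, mul_left_comm]
  have h4 : P.braidingDefect k q ≤
      1 / (2 : ℝ) ^ G.n k * ∑ b, 1 / (2 : ℝ) ^ G.n k * ∑ a, D (.basis .Z) a b + ν := by
    rw [braidingDefect_eq, hcard]
    refine (average_add_const_le hne fun a _ => average_add_const_le hne fun b _ =>
      hD q (.basis .Z) a b).trans (le_of_eq (congrArg (· + ν) ?_))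
    simp only [← Finset.mul_sum]
    rw [Finset.sum_comm]
  linarith

end Prover

end PauliBraiding

theorem mainTheorem11 (μ : ℝ) (hμ : μ < 1) :
    ∃ C : ℝ, ∀ (adv : PauliBraiding.Advice) (E : PauliBraiding.EncryptionScheme)
      (_ : E.Secure adv)
      (G : PauliBraiding.Setup E) (_ : ∀ k, PauliBraiding.IsBiased μ (G.S k))
      (P : PauliBraiding.Prover G) (_ : P.Efficient adv)
      (ε : ℕ → ℝ) (_ : ∀ k, 1 - ε k ≤ P.braidingWin k)
      (_ : ∀ k, 1 - ε k ≤ P.consistencyWin k),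
      ∃ η : ℕ → ℝ, PauliBraiding.Negligible η ∧
        ∀ (k : ℕ) (q : PauliBraiding.AliceQuestion (G.S k)),
          P.braidingDefect k q ≤ C * ε k + η k := by
  refine ⟨4 / (1 - μ) * (4 / (1 - μ) * 45360 + (32 / (1 - μ) + 16)) + (32 / (1 - μ) + 16),
    fun adv E hE G hS P hP ε hw hw' => ?_⟩
  obtain ⟨ν, hν, hν0, hswitch⟩ := P.exists_negligible_switch hE hP
  exact ⟨fun k => (4 / (1 - μ) * (4 / (1 - μ) * 72 + 1) + 1) * ν k, hν.const_mul _, fun k q =>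
    P.braidingDefect_le (hP.1 k).nsq_eq_one hμ (hS k) (hswitch k) (hν0 k) (hw k) (hw' k) q⟩
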